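/- Let $r>1$ be an integer, let $p_1,\dots,p_r$ be distinct primes, let $\alpha_1,\dots,\alpha_r$ be positive integers, and let $m=\prod_{i=1}^r p_i^{\alpha_i}$. Then there exist a real number $c=c(m)>0$ and an explicitly constructible family of set-systems $\mathcal{H}=\mathcal{H}_h$, where $\mathcal{H}_h$ is a family of (distinct) subsets of a universe of $h$ elements, such that for every integer $h\ge m$ the set-system $\mathcal{H}=\mathcal{H}_h$ is non-uniform (its members do not all have the same size) and the following hold: 1. $|\mathcal{H}| > \exp\left(c\,\dfrac{1.5\,(\log h)^r}{(\log\log h)^{r-1}}\right)$; 2. $|H| \equiv 0 \pmod m$ for all $H\in\mathcal{H}$; 3. for all $G,H\in\mathcal{H}$ with $G\ne H$: if $H\subset G$ or $G\subset H$, then $|G\cap H|\equiv 0 \pmod m$, and otherwise $|G\cap H|\not\equiv 0\pmod m$; 4. for all $G,H\in\mathcal{H}$ with $G\neq H$ and all $i\in\{1,\dots,r\}$, the residue $|G\cap H| \bmod p_i^{\alpha_i}$ lies in $\{0,1\}$. Here "explicitly constructible" means that there is an algorithm (depending on $m$ and the chosen primes and exponents only) that, given $h$, lists the members of $\mathcal{H}_h$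 in time polynomial in $h$ and $|\mathcal{H}_h|$. -/

import Mathlib

/-- Binary trees, the data on which programs operate. `nil` doubles as the empty list and the
truth value "false"; `cons a l` is the list with first entry `a` and remaining entries `l`. -/
inductive Data : Type
  | nil : Data
  | cons : Data → Data → Data

namespace Data

/-- First component; `nil` is sent to `nil`. -/
def head : Data → Data
  | nil => nil
  | cons a _ => a

/-- Second component; `nil` is sent to `nil`. -/
def tail : Data → Data
  | nil => nil
  | cons _ b => b

/-- The entries of a tree that is read as a list. -/
def toList : Data → List Data
  | nil => []
  | cons a b => a :: toList b

/-- The tree that represents a list of trees. -/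
def ofList : List Data → Data
  | [] => nil
  | a :: l => cons a (ofList l)

/-- The natural number `h` in unary: a list of `h` entries `nil`. -/
def ofNat (h : ℕ) : Data := ofList (List.replicate h nil)

/-- The bits: `nil` for 0 and `cons nil nil` for 1. -/
def ofBool (b : Bool) : Data := if b then cons nil nil else nil

/-- A subset of `{0, …, h - 1}`, written as its characteristic vector, a list of `h` bits. -/
def ofSet {h : ℕ} (S : Finset (Fin h)) : Data :=
  ofList ((List.finRange h).map fun i => ofBool (decide (i ∈ S)))

/-- A list of subsets of `{0, …, h - 1}`: the list of their characteristic vectors. -/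
def ofSets {h : ℕ} (L : List (Finset (Fin h))) : Data :=
  ofList (L.map ofSet)

end Data

/-- A small list-processing programming language. Every program maps a tree to a tree. -/
inductive Prog : Type
  /-- returns its input -/
  | id : Prog
  /-- returns `nil` -/
  | nil : Prog
  /-- first component of the input -/
  | head : Prog
  /-- second component of the input -/
  | tail : Prog
  /-- `cons p q` runs `p` and `q` on the input and pairs the results -/
  | cons : Prog → Prog → Prog
  /-- `comp q p` runs `p` on the input and then `q` on the result -/
  | comp : Prog → Prog → Prog
  /-- `ite b p q` runs `q` if `b` returns `nil` on the input, and `p` otherwise -/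
  | ite : Prog → Prog → Prog → Prog
  /-- `loop p`, on input `cons s l`: for each entry `y` of the list `l`, in order, replace the
  state `s` by the result of `p` on `cons s y`; return the final state -/
  | loop : Prog → Prog

namespace Prog

/-- The state after running through the list, if `f` is the body of the loop. -/
def loopEval (f : Data → Data) : Data → List Data → Data
  | s, [] => s
  | s, y :: l => loopEval f (f (Data.cons s y)) l

/-- The number of steps of a loop, if `f` is its body and `t` the running time of the body. -/
def loopTime (f : Data → Data) (t : Data → ℕ) : Data → List Data → ℕ
  | _, [] => 1
  | s, y :: l => 1 + t (Data.cons s y) + loopTime f t (f (Data.cons s y)) l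

/-- The result of a program. -/
def eval : Prog → Data → Data
  | id, x => x
  | nil, _ => Data.nil
  | head, x => x.head
  | tail, x => x.tail
  | cons p q, x => Data.cons (eval p x) (eval q x)
  | comp q p, x => eval q (eval p x)
  | ite b p q, x =>
      match eval b x with
      | Data.nil => eval q x
      | Data.cons _ _ => eval p x
  | loop p, x => loopEval (eval p) x.head x.tail.toList

/-- The running time of a program: the number of elementary operations that it carries out.
Each of them takes constant time on a machine that stores a tree as a cell with two pointers,
so up to a polynomial this is the running time of a Turing machine. -/
def time : Prog → Data → ℕ
  | id, _ => 1
  | nil, _ => 1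
  | head, _ => 1
  | tail, _ => 1
  | cons p q, x => 1 + time p x + time q x
  | comp q p, x => 1 + time p x + time q (eval p x)
  | ite b p q, x =>
      1 + time b x +
        match eval b x with
        | Data.nil => time q x
        | Data.cons _ _ => time p x
  | loop p, x => loopTime (eval p) (time p) x.head x.tail.toList

end Prog

/-- A family of set-systems, `𝓗 h` on the `h` elements of `Fin h`, is explicitly constructible
if one program lists, on input `h`, the members of `𝓗 h`, each of them once, in time polynomial
in `h` and the number of the members (that is, polynomial in the size of the set-system). -/
def ExplicitlyConstructible (𝓗 : (h : ℕ) → Finset (Finset (Fin h))) : Prop :=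
  ∃ (P : Prog) (T : Polynomial ℕ), ∀ h : ℕ,
    (∃ L : List (Finset (Fin h)),
      L.Nodup ∧ (∀ S, S ∈ L ↔ S ∈ 𝓗 h) ∧ P.eval (Data.ofNat h) = Data.ofSets L) ∧
    P.time (Data.ofNat h) ≤ T.eval (h + (𝓗 h).card)

/-- A set-system is non-uniform if its members do not all have the same size. -/
def NonUniform {h : ℕ} (H : Finset (Finset (Fin h))) : Prop :=
  ∃ A ∈ H, ∃ B ∈ H, A.card ≠ B.card

/-! Choose exponents `e i` with `p i ^ e i` of order log h / log log h and put n = ∏ p i ^ e i - 1.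
The large members are indexed by the words of length n over an alphabet of `Nat.log 2 h` letters.
Two members whose words agree in exactly a positions meet in f(a) points, where f(a) ≡ 1 - C(a, p i
^ e i - 1) ^ (α i * φ(p i ^ α i)) modulo `p i ^ α i`. By Euler's theorem this residue is 0 or 1, and
it is 0 exactly when `p i` does not divide the binomial coefficient, that is, when `p i ^ e i`
divides a + 1 (`dvd_choose_of_not_dvd`, `choose_prime_pow_sub_one_modEq`). Hence m divides f(a) iff
n + 1 divides a + 1; as a ≤ n, this means a = n, i.e. equal words (`intersectionSize_mod_prod`). So
the sizes are 0 modulo m and the intersections of distinct members are not; in particular these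
members are pairwise incomparable. Adding the empty set, which is comparable to everything, destroys
uniformity.

Sets with these intersections exist because f is a nonnegative combination of powers of binomial
coefficients. C(a, k) counts the sets of k positions on which both words agree, so the points are
choices of k positions with a letter at each; a K-th power needs K-tuples of such points, a
coefficient needs disjoint copies (`card_inter_supportSet`). About (n log h)^(kK) points are used,
and the choice of `scale` keeps this below √h, which leaves a factor √h for the copies. Since log
|𝓗| is at least n log (`Nat.log 2 h`), and n is of order (log h / log log h)^r, the size bound
follows (`log_pow_div_le`).

For constructibility, `Feasible` is closed under list and arithmetic operations. Its index type
carries the side conditions on the input, and `B` is the quantity in which running times are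
polynomial, finally h + |𝓗|. All intermediate lists are polynomially long in it, because the list of
words has fewer than |𝓗| entries. -/

/-! ### Tree codes and polynomial bounds. -/

/-- Types whose elements are represented by trees. -/
class TreeCode (α : Type) where
  /-- the tree that represents an element -/
  code : α → Data

open TreeCode (code)

instance : TreeCode Unit := ⟨fun _ => Data.nil⟩
instance : TreeCode ℕ := ⟨Data.ofNat⟩
instance {α : Type} [TreeCode α] : TreeCode (List α) := ⟨fun l => Data.ofList (l.map code)⟩
instance {α β : Type} [TreeCode α] [TreeCode β] : TreeCode (α × β) :=
  ⟨fun x => Data.cons (code x.1) (code x.2)⟩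

section codes

variable {α β : Type} [TreeCode α] [TreeCode β]

theorem code_prod (a : α) (b : β) : code (a, b) = Data.cons (code a) (code b) := rfl
theorem code_zero : code 0 = Data.nil := rfl
theorem code_succ (n : ℕ) : code (n + 1) = Data.cons Data.nil (code n) := rfl

theorem code_replicate (n : ℕ) : code (List.replicate n ()) = code n := by
  change Data.ofList _ = Data.ofList _
  rw [List.map_replicate]
  rfl

theorem toList_ofList (l : List Data) : (Data.ofList l).toList = l := by
  induction l with
  | nil => rfl
  | cons a l ih => simp [Data.ofList, Data.toList, ih]

end codes

/-- `f` is bounded by a polynomial in `B`. -/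
def PolyBounded {ι : Type} (B f : ι → ℕ) : Prop :=
  ∃ T : Polynomial ℕ, ∀ i, f i ≤ T.eval (B i)

namespace PolyBounded

variable {ι κ : Type} {B f g : ι → ℕ}

theorem self : PolyBounded B B := ⟨Polynomial.X, fun i => by simp⟩

theorem const (c : ℕ) : PolyBounded B fun _ => c := ⟨Polynomial.C c, fun i => by simp⟩

theorem mono (hg : PolyBounded B g) (h : ∀ i, f i ≤ g i) : PolyBounded B f :=
  let ⟨T, hT⟩ := hg
  ⟨T, fun i => (h i).trans (hT i)⟩

theorem add (hf : PolyBounded B f) (hg : PolyBounded B g) : PolyBounded B fun i => f i + g i :=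
  let ⟨S, hS⟩ := hf
  let ⟨T, hT⟩ := hg
  ⟨S + T, fun i => by simpa using add_le_add (hS i) (hT i)⟩

theorem mul (hf : PolyBounded B f) (hg : PolyBounded B g) : PolyBounded B fun i => f i * g i :=
  let ⟨S, hS⟩ := hf
  let ⟨T, hT⟩ := hg
  ⟨S * T, fun i => by simpa using Nat.mul_le_mul (hS i) (hT i)⟩

theorem pow (hf : PolyBounded B f) (c : ℕ) : PolyBounded B fun i => f i ^ c := by
  induction c with
  | zero => simpa using const 1
  | succ c ih => simpa only [pow_succ] using ih.mul hf

theorem reindex {B' f' : κ → ℕ} (hf : PolyBounded B f) (u : κ → ι)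
    (hB : ∀ j, B' j = B (u j) := by intro; rfl) (hf' : ∀ j, f' j = f (u j) := by intro; rfl) :
    PolyBounded B' f' :=
  let ⟨T, hT⟩ := hf
  ⟨T, fun j => by rw [hB, hf']; exact hT (u j)⟩

end PolyBounded

/-! ### Closure properties of polynomial-time computation. -/

theorem loop_spec {f : Data → Data} {t : Data → ℕ} {C : ℕ} (l : List Data) (s : ℕ → Data)
    (h : ∀ k (hk : k < l.length), f (Data.cons (s k) l[k]) = s (k + 1) ∧
      t (Data.cons (s k) l[k]) ≤ C) :
    Prog.loopEval f (s 0) l = s l.length ∧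
      Prog.loopTime f t (s 0) l ≤ 1 + l.length * (1 + C) := by
  induction l generalizing s with
  | nil => simp [Prog.loopEval, Prog.loopTime]
  | cons y l ih =>
    have h0 := h 0 (by simp)
    have := ih (fun k => s (k + 1)) fun k hk =>
      h (k + 1) (by simpa using hk)
    simp only [List.getElem_cons_zero, zero_add] at h0 this
    simp only [Prog.loopEval, Prog.loopTime, h0.1, List.length_cons]
    refine ⟨this.1, ?_⟩
    have h1 := this.2
    have h2 := h0.2
    rw [add_mul, one_mul]
    omega

/-- One program computes `f i` from `x i` for all `i`, in time polynomial in `B i`. -/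
def Feasible {ι α β : Type} [TreeCode α] [TreeCode β] (B : ι → ℕ) (x : ι → α) (f : ι → β) :
    Prop :=
  ∃ P : Prog, (∀ i, P.eval (code (x i)) = code (f i)) ∧
    PolyBounded B fun i => P.time (code (x i))

namespace Feasible

variable {ι κ α β γ σ : Type} [TreeCode α] [TreeCode β] [TreeCode γ] [TreeCode σ]
  {B : ι → ℕ} {x : ι → α}

theorem id : Feasible B x x :=
  ⟨Prog.id, fun _ => rfl, PolyBounded.const 1⟩

theorem congr {f : ι → β} (hf : Feasible B x f) {g : ι → γ} (h : ∀ i, code (g i) = code (f i)) :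
    Feasible B x g :=
  let ⟨P, hP, hT⟩ := hf
  ⟨P, fun i => (hP i).trans (h i).symm, hT⟩

theorem of_eq {f g : ι → β} (hf : Feasible B x f) (h : ∀ i, g i = f i) : Feasible B x g :=
  hf.congr fun i => by rw [h i]

theorem reindex {f : ι → β} {B' : κ → ℕ} {x' : κ → α} {f' : κ → β} (hf : Feasible B x f)
    (u : κ → ι) (hB : ∀ j, B' j = B (u j) := by intro; rfl)
    (hx : ∀ j, x' j = x (u j) := by intro; rfl) (hf' : ∀ j, f' j = f (u j) := by intro; rfl) :
    Feasible B' x' f' :=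
  let ⟨P, hP, hT⟩ := hf
  ⟨P, fun j => by rw [hx, hf']; exact hP (u j), hT.reindex u hB fun j => by rw [hx]⟩

theorem comp {f : ι → β} {g : ι → γ} (hf : Feasible B x f) (hg : Feasible B f g) :
    Feasible B x g := by
  obtain ⟨P, hP, hT⟩ := hf
  obtain ⟨Q, hQ, hS⟩ := hg
  refine ⟨Prog.comp Q P, fun i => by simp only [Prog.eval, hP, hQ], ?_⟩
  simp only [Prog.time, hP]
  exact ((PolyBounded.const 1).add hT).add hS

/-- A function of `x` is a function of any data from which `x` can be computed. -/
theorem lift {f : ι → β} {B' : κ → ℕ} {y : κ → γ} {f' : κ → β} (hf : Feasible B x f)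
    (u : κ → ι) (hy : Feasible B' y fun j => x (u j)) (hB : ∀ j, B' j = B (u j) := by intro; rfl)
    (hf' : ∀ j, f' j = f (u j) := by intro; rfl) : Feasible B' y f' :=
  hy.comp (hf.reindex u hB (fun _ => rfl) hf')

theorem const (b : β) : Feasible B x fun _ => b := by
  have key : ∀ d : Data, ∃ (P : Prog) (c : ℕ), ∀ y, P.eval y = d ∧ P.time y ≤ c := by
    intro d
    induction d with
    | nil => exact ⟨Prog.nil, 1, fun y => ⟨rfl, le_rfl⟩⟩
    | cons a b iha ihb =>
      obtain ⟨P, c, hP⟩ := iha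
      obtain ⟨Q, d, hQ⟩ := ihb
      refine ⟨Prog.cons P Q, 1 + c + d, fun y => ⟨?_, ?_⟩⟩
      · simp only [Prog.eval, (hP y).1, (hQ y).1]
      · have h1 := (hP y).2
        have h2 := (hQ y).2
        simp only [Prog.time]
        omega
  obtain ⟨P, c, hP⟩ := key (code b)
  exact ⟨P, fun i => (hP _).1, (PolyBounded.const c).mono fun i => (hP _).2⟩

theorem pair {f : ι → β} {g : ι → γ} (hf : Feasible B x f) (hg : Feasible B x g) :
    Feasible B x fun i => (f i, g i) := by
  obtain ⟨P, hP, hT⟩ := hf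
  obtain ⟨Q, hQ, hS⟩ := hg
  exact ⟨Prog.cons P Q, fun i => by simp only [Prog.eval, hP, hQ, code_prod],
    ((PolyBounded.const 1).add hT).add hS⟩

theorem fst {f : ι → β × γ} (hf : Feasible B x f) : Feasible B x fun i => (f i).1 := by
  obtain ⟨P, hP, hT⟩ := hf
  refine ⟨Prog.comp Prog.head P, fun i => by simp only [Prog.eval, hP]; rfl, ?_⟩
  exact ((PolyBounded.const 1).add hT).add (PolyBounded.const 1)

theorem snd {f : ι → β × γ} (hf : Feasible B x f) : Feasible B x fun i => (f i).2 := by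
  obtain ⟨P, hP, hT⟩ := hf
  refine ⟨Prog.comp Prog.tail P, fun i => by simp only [Prog.eval, hP]; rfl, ?_⟩
  exact ((PolyBounded.const 1).add hT).add (PolyBounded.const 1)

theorem cons {f : ι → β} {l : ι → List β} (hf : Feasible B x f) (hl : Feasible B x l) :
    Feasible B x fun i => f i :: l i :=
  (hf.pair hl).congr fun _ => rfl

theorem succ {n : ι → ℕ} (hn : Feasible B x n) : Feasible B x fun i => n i + 1 :=
  ((const ()).pair hn).congr fun _ => rfl

theorem pred {n : ι → ℕ} (hn : Feasible B x n) : Feasible B x fun i => n i - 1 := by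
  obtain ⟨P, hP, hT⟩ := hn
  refine ⟨Prog.comp Prog.tail P, fun i => ?_,
    ((PolyBounded.const 1).add hT).add (PolyBounded.const 1)⟩
  simp only [Prog.eval, hP]
  cases n i <;> rfl

/-- Case distinction, where each case is only required to be feasible where it applies. -/
theorem cases {n : ι → ℕ} {f : ι → β} (hn : Feasible B x n)
    (h0 : Feasible (ι := {i // n i = 0}) (fun i => B i) (fun i => x i) fun i => f i)
    (h1 : Feasible (ι := {i // n i ≠ 0}) (fun i => B i) (fun i => x i) fun i => f i) :
    Feasible B x f := by
  obtain ⟨P, hP, S, hS⟩ := hn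
  obtain ⟨P₀, hP₀, S₀, hS₀⟩ := h0
  obtain ⟨P₁, hP₁, S₁, hS₁⟩ := h1
  refine ⟨Prog.ite P P₁ P₀, fun i => ?_, 1 + S + (S₀ + S₁), fun i => ?_⟩
  · simp only [Prog.eval, hP]
    by_cases h : n i = 0
    · rw [h]
      exact hP₀ ⟨i, h⟩
    · obtain ⟨k, hk⟩ := Nat.exists_eq_succ_of_ne_zero h
      rw [hk]
      exact hP₁ ⟨i, h⟩
  · simp only [Prog.time, hP, Polynomial.eval_add, Polynomial.eval_one]
    have h2 := hS i
    by_cases h : n i = 0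
    · have h3 := hS₀ ⟨i, h⟩
      simp only at h2 h3
      rw [h]
      simp only [code_zero]
      omega
    · have h3 := hS₁ ⟨i, h⟩
      simp only at h2 h3
      obtain ⟨k, hk⟩ := Nat.exists_eq_succ_of_ne_zero h
      rw [hk, Nat.succ_eq_add_one]
      simp only [code_succ]
      omega

theorem ite {n : ι → ℕ} {f g : ι → β} (hn : Feasible B x n) (hf : Feasible B x f)
    (hg : Feasible B x g) : Feasible B x fun i => if n i = 0 then f i else g i := by
  refine cases hn ?_ ?_
  · exact (hf.reindex Subtype.val).of_eq fun i => by simp [i.2]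
  · exact (hg.reindex Subtype.val).of_eq fun i => by simp [i.2]

/-- The body is indexed by pairs of an input and a step, but its time is measured by the input
alone, so one polynomial bounds all steps of a run. The prescribed states `s` serve as the loop
invariant. -/
theorem loop {l : ι → List γ} {s : ι → ℕ → σ} (hl : Feasible B x l)
    (hlen : PolyBounded B fun i => (l i).length) (h0 : Feasible B x fun i => s i 0)
    (hs : Feasible (ι := {j : ι × ℕ // j.2 < (l j.1).length}) (fun j => B j.1.1)
      (fun j => ((x j.1.1, s j.1.1 j.1.2), (l j.1.1)[j.1.2]'j.2))
      fun j => s j.1.1 (j.1.2 + 1)) :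
    Feasible B x fun i => s i (l i).length := by
  obtain ⟨P, hP, hPT⟩ := hl
  obtain ⟨Q, hQ, hQT⟩ := h0
  obtain ⟨R, hR, T, hT⟩ := hs
  -- The state is paired with the input `x i`, which every round copies, so that the body can still
  -- read it.
  have key : ∀ i, _ := fun i => loop_spec
    (f := (Prog.cons (Prog.comp Prog.head Prog.head) R).eval)
    (t := (Prog.cons (Prog.comp Prog.head Prog.head) R).time) (C := 4 + T.eval (B i))
    ((l i).map code) (fun k => code (x i, s i k)) (by
      intro k hk
      have hk' : k < (l i).length := by simpa using hk
      have h1 := hR ⟨(i, k), hk'⟩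
      have h2 := hT ⟨(i, k), hk'⟩
      simp only [code_prod] at h1 h2
      simp only [List.getElem_map, Prog.eval, Prog.time, code_prod, h1, Data.head, true_and]
      omega)
  refine ⟨Prog.comp Prog.tail (Prog.comp
    (Prog.loop (Prog.cons (Prog.comp Prog.head Prog.head) R))
    (Prog.cons (Prog.cons Prog.id Q) P)), fun i => ?_, ?_⟩
  · have h1 := (key i).1
    rw [code_prod, code_prod, List.length_map] at h1
    simp only [Prog.eval, hQ, hP, Data.head, Data.tail] at h1 ⊢
    rw [show (code (l i)).toList = (l i).map code from toList_ofList _, h1]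
  · have h2 : PolyBounded B fun i => 1 + (l i).length * (1 + (4 + T.eval (B i))) :=
      (PolyBounded.const 1).add (hlen.mul ((PolyBounded.const 1).add
        ((PolyBounded.const 4).add ⟨T, fun _ => le_rfl⟩)))
    refine (((PolyBounded.const 6).add (hQT.add hPT)).add h2).mono fun i => ?_
    have h1 := (key i).2
    rw [code_prod, List.length_map] at h1
    simp only [Prog.time, Prog.eval, hQ, hP, Data.head, Data.tail] at h1 ⊢
    rw [show (code (l i)).toList = (l i).map code from toList_ofList _]
    omega

theorem natRec {n : ι → ℕ} {s : ι → ℕ → σ} (hn : Feasible B x n) (hlen : PolyBounded B n)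
    (h0 : Feasible B x fun i => s i 0)
    (hs : Feasible (ι := {j : ι × ℕ // j.2 < n j.1}) (fun j => B j.1.1)
      (fun j => (x j.1.1, s j.1.1 j.1.2)) fun j => s j.1.1 (j.1.2 + 1)) :
    Feasible B x fun i => s i (n i) := by
  have h1 : Feasible B x fun i => List.replicate (n i) () := hn.congr fun i => code_replicate _
  refine (loop (s := s) h1 (by simpa using hlen) h0 ?_).of_eq fun i => by simp
  exact hs.lift (fun j => ⟨j.1, by simpa using j.2⟩) id.fst

theorem reverse {l : ι → List β} (hl : Feasible B x l)
    (hlen : PolyBounded B fun i => (l i).length) : Feasible B x fun i => (l i).reverse := by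
  refine (loop (s := fun i k => ((l i).take k).reverse) hl hlen ?_ ?_).of_eq fun i => by simp
  · exact (const []).of_eq fun i => by simp
  · refine (id.snd.cons id.fst.snd).of_eq fun j => ?_
    rw [List.take_succ_eq_append_getElem j.2]
    simp

/-- Loops consume a list from the left, so it is reversed first. Indexing the body by suffixes of `l
i` lets size bounds on partial folds be used inside it. -/
theorem foldr {l : ι → List γ} {z : ι → σ} {g : ι → γ → σ → σ} (hl : Feasible B x l)
    (hlen : PolyBounded B fun i => (l i).length) (hz : Feasible B x z)
    (hg : Feasible (ι := {j : ι × γ × List γ // j.2.1 :: j.2.2 <:+ l j.1}) (fun j => B j.1.1)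
      (fun j => ((x j.1.1, j.1.2.2.foldr (g j.1.1) (z j.1.1)), j.1.2.1))
      fun j => g j.1.1 j.1.2.1 (j.1.2.2.foldr (g j.1.1) (z j.1.1))) :
    Feasible B x fun i => (l i).foldr (g i) (z i) := by
  refine (loop (l := fun i => (l i).reverse)
    (s := fun i k => ((l i).drop ((l i).length - k)).foldr (g i) (z i)) (hl.reverse hlen)
    (by simpa using hlen) ?_ ?_).of_eq fun i => by simp
  · simpa using hz
  · have key : ∀ j : {j : ι × ℕ // j.2 < ((l j.1).reverse).length},
        ((l j.1.1).reverse)[j.1.2]'j.2 :: (l j.1.1).drop ((l j.1.1).length - j.1.2) =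
          (l j.1.1).drop ((l j.1.1).length - (j.1.2 + 1)) := by
      rintro ⟨⟨i, k⟩, hk⟩
      have hk' : k < (l i).length := by simpa using hk
      simp only
      rw [List.drop_eq_getElem_cons (i := (l i).length - (k + 1)) (by omega)]
      simp only [List.getElem_reverse, List.cons.injEq]
      exact ⟨by congr 1; omega, by congr 1; omega⟩
    refine hg.reindex (fun j => ⟨(j.1.1, ((l j.1.1).reverse)[j.1.2]'j.2,
      (l j.1.1).drop ((l j.1.1).length - j.1.2)), ?_⟩) (fun _ => rfl) (fun _ => rfl) fun j => ?_
    · simp only [key]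
      exact List.drop_suffix _ _
    · exact congrArg (fun t => t.foldr (g j.1.1) (z j.1.1)) (key j).symm

theorem append {l l' : ι → List β} (hl : Feasible B x l) (hl' : Feasible B x l')
    (hlen : PolyBounded B fun i => (l i).length) : Feasible B x fun i => l i ++ l' i := by
  refine (foldr (g := fun _ b t => b :: t) hl hlen hl' ?_).of_eq fun i => by simp
  exact id.snd.cons id.fst.snd

theorem map {l : ι → List γ} {g : ι → γ → β} (hl : Feasible B x l)
    (hlen : PolyBounded B fun i => (l i).length)
    (hg : Feasible (ι := {j : ι × γ // j.2 ∈ l j.1}) (fun j => B j.1.1)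
      (fun j => (x j.1.1, j.1.2)) fun j => g j.1.1 j.1.2) :
    Feasible B x fun i => (l i).map (g i) := by
  refine (foldr (g := fun i c t => g i c :: t) hl hlen (const []) ?_).of_eq fun i => by
    rw [List.map_eq_foldr]
  refine cons ?_ id.fst.snd
  exact hg.lift (fun j => ⟨(j.1.1, j.1.2.1), j.2.subset (by simp)⟩) (id.fst.fst.pair id.snd)

theorem flatMap {l : ι → List γ} {g : ι → γ → List β} (hl : Feasible B x l)
    (hlen : PolyBounded B fun i => (l i).length)
    (hg : Feasible (ι := {j : ι × γ // j.2 ∈ l j.1}) (fun j => B j.1.1)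
      (fun j => (x j.1.1, j.1.2)) fun j => g j.1.1 j.1.2)
    (hglen : PolyBounded (ι := {j : ι × γ // j.2 ∈ l j.1}) (fun j => B j.1.1)
      fun j => (g j.1.1 j.1.2).length) :
    Feasible B x fun i => (l i).flatMap (g i) := by
  refine (foldr (g := fun i c t => g i c ++ t) hl hlen (const []) ?_).of_eq fun i => by
    induction l i with
    | nil => rfl
    | cons c t ih => rw [List.flatMap_cons, ih, List.foldr_cons]
  refine append ?_ id.fst.snd ?_
  · exact hg.lift (fun j => ⟨(j.1.1, j.1.2.1), j.2.subset (by simp)⟩) (id.fst.fst.pair id.snd)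
  · exact hglen.reindex fun j => ⟨(j.1.1, j.1.2.1), j.2.subset (by simp)⟩

theorem add {m n : ι → ℕ} (hm : Feasible B x m) (hn : Feasible B x n)
    (hlen : PolyBounded B n) : Feasible B x fun i => m i + n i :=
  natRec (s := fun i k => m i + k) hn hlen hm id.snd.succ

theorem sub {m n : ι → ℕ} (hm : Feasible B x m) (hn : Feasible B x n)
    (hlen : PolyBounded B n) : Feasible B x fun i => m i - n i :=
  natRec (s := fun i k => m i - k) hn hlen hm
    (id.snd.pred.of_eq fun j => by simp only; omega)

theorem mul {m n : ι → ℕ} (hm : Feasible B x m) (hn : Feasible B x n)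
    (hmlen : PolyBounded B m) (hnlen : PolyBounded B n) : Feasible B x fun i => m i * n i :=
  natRec (s := fun i k => m i * k) hn hnlen (const 0)
    (id.snd.add (hm.lift (fun j => j.1.1) id.fst) (hmlen.reindex fun j => j.1.1))

theorem length {l : ι → List β} (hl : Feasible B x l)
    (hlen : PolyBounded B fun i => (l i).length) : Feasible B x fun i => (l i).length :=
  loop (s := fun _ k => k) hl hlen (const 0) id.fst.snd.succ

theorem range {n : ι → ℕ} (hn : Feasible B x n) (hlen : PolyBounded B n) :
    Feasible B x fun i => List.range (n i) := by
  refine natRec (s := fun _ k => List.range k) hn hlen (const []) ?_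
  refine ((const 0).cons (id.snd.map (g := fun _ => Nat.succ) ?_ id.snd.succ)).of_eq fun j =>
    List.range_succ_eq_map
  exact (hlen.reindex fun j => j.1.1).mono fun j => by simpa using j.2.le

theorem replicate {n : ι → ℕ} {f : ι → β} (hn : Feasible B x n) (hlen : PolyBounded B n)
    (hf : Feasible B x f) : Feasible B x fun i => List.replicate (n i) (f i) :=
  natRec (s := fun i k => List.replicate k (f i)) hn hlen (const [])
    ((hf.lift (fun j => j.1.1) id.fst).cons id.snd)

theorem constFlatMap {δ : Type} (D : List δ) {f : δ → ι → List β}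
    (hf : ∀ d, Feasible B x (f d)) (hlen : ∀ d, PolyBounded B fun i => (f d i).length) :
    Feasible B x fun i => D.flatMap fun d => f d i := by
  induction D with
  | nil => exact const []
  | cons d D ih => simpa using (hf d).append ih (hlen d)

theorem constProd {δ : Type} (D : List δ) {f : δ → ι → ℕ}
    (hf : ∀ d, Feasible B x (f d)) (hlen : ∀ d, PolyBounded B (f d)) :
    Feasible B x (fun i => (D.map fun d => f d i).prod) ∧
      PolyBounded B fun i => (D.map fun d => f d i).prod := by
  induction D with
  | nil => exact ⟨const 1, PolyBounded.const 1⟩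
  | cons d D ih =>
    simp only [List.map_cons, List.prod_cons]
    exact ⟨(hf d).mul ih.1 (hlen d) ih.2, (hlen d).mul ih.2⟩

/-- The largest power of `p` whose product with `d` is at most `n`, and its exponent. -/
theorem log_div {n d : ι → ℕ} {p : ℕ} (hp : 1 < p) (hn : Feasible B x n)
    (hnlen : PolyBounded B n) (hd : Feasible B x d) (hdlen : PolyBounded B d)
    (hd0 : ∀ i, 0 < d i) :
    Feasible B x fun i => (Nat.log p (n i / d i), p ^ Nat.log p (n i / d i)) := by
  -- No early exit is needed: the state is capped at the logarithm, which is at most `n i`, and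
  -- idles afterwards. Comparing `p ^ k * p * d i` with `n i` avoids division.
  refine (natRec (s := fun i k => (min k (Nat.log p (n i / d i)),
    p ^ min k (Nat.log p (n i / d i)))) hn hnlen ?_ ?_).of_eq fun i => ?_
  · exact (const (0, 1)).of_eq fun i => by simp
  · have hpow : PolyBounded (ι := {j : ι × ℕ // j.2 < n j.1}) (fun j => B j.1.1)
        fun j => p ^ min j.1.2 (Nat.log p (n j.1.1 / d j.1.1)) := by
      -- The summand 1 covers the case `n / d = 0`, where the logarithm is 0 by convention and the
      -- power is 1.
      refine ((hnlen.add (PolyBounded.const 1)).reindex fun j => j.1.1).mono fun j => ?_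
      have h1 : p ^ min j.1.2 (Nat.log p (n j.1.1 / d j.1.1)) ≤
          p ^ Nat.log p (n j.1.1 / d j.1.1) :=
        Nat.pow_le_pow_right (by omega) (min_le_right _ _)
      rcases Nat.eq_zero_or_pos (n j.1.1 / d j.1.1) with h | h
      · rw [h, Nat.log_zero_right, pow_zero] at h1
        rw [h, Nat.log_zero_right]
        omega
      · have h2 := Nat.pow_log_le_self p h.ne'
        have h3 := Nat.div_le_self (n j.1.1) (d j.1.1)
        omega
    have hn' := hn.lift (fun j : {j : ι × ℕ // j.2 < n j.1} => j.1.1)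
      (y := fun j => (x j.1.1, min j.1.2 (Nat.log p (n j.1.1 / d j.1.1)),
        p ^ min j.1.2 (Nat.log p (n j.1.1 / d j.1.1)))) id.fst
    have hd' := hd.lift (fun j : {j : ι × ℕ // j.2 < n j.1} => j.1.1)
      (y := fun j => (x j.1.1, min j.1.2 (Nat.log p (n j.1.1 / d j.1.1)),
        p ^ min j.1.2 (Nat.log p (n j.1.1 / d j.1.1)))) id.fst
    have hdl := hdlen.reindex fun j : {j : ι × ℕ // j.2 < n j.1} => j.1.1
    have hP := (id (B := fun j : {j : ι × ℕ // j.2 < n j.1} => B j.1.1)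
      (x := fun j => (x j.1.1, min j.1.2 (Nat.log p (n j.1.1 / d j.1.1)),
        p ^ min j.1.2 (Nat.log p (n j.1.1 / d j.1.1))))).snd.snd
    have hPp := hP.mul (const p) hpow (PolyBounded.const p)
    have hPpd := hPp.mul hd' (hpow.mul (PolyBounded.const p)) hdl
    refine (ite (hPpd.sub hn' (hnlen.reindex fun j => j.1.1)) (id.snd.fst.succ.pair hPp)
      id.snd).of_eq fun j => ?_
    obtain ⟨⟨i, k⟩, hk⟩ := j
    simp only
    set L := Nat.log p (n i / d i) with hL
    have hiff : p ^ min k L * p * d i - n i = 0 ↔ p ^ (min k L + 1) ≤ n i / d i := by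
      rw [Nat.le_div_iff_mul_le (hd0 i), pow_succ]
      omega
    by_cases hkL : k < L
    · have h1 : p ^ (min k L + 1) ≤ n i / d i := by
        refine Nat.pow_le_of_le_log ?_ (by omega)
        intro h
        rw [h, Nat.log_zero_right] at hL
        omega
      rw [if_pos (hiff.2 h1), min_eq_left (by omega : k + 1 ≤ L), min_eq_left (by omega : k ≤ L),
        pow_succ]
    · have h1 : ¬ p ^ (min k L + 1) ≤ n i / d i := by
        rw [min_eq_right (by omega : L ≤ k), not_le]
        exact Nat.lt_pow_succ_log_self hp _
      rw [if_neg (fun h => h1 (hiff.1 h)), min_eq_right (by omega : L ≤ k),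
        min_eq_right (by omega : L ≤ k + 1)]
  · have h1 : Nat.log p (n i / d i) ≤ n i :=
      (Nat.log_le_self _ _).trans (Nat.div_le_self _ _)
    simp only [min_eq_right h1]

end Feasible

/-! ### Incidence vectors over a commutative monoid with zero. -/

section incidence

variable {M M' : Type} [CommMonoidWithZero M] [CommMonoidWithZero M']

/-- Each product may be multiplied by an entry of `u`, if its budget is not exhausted. -/
def expand (u : List M) (L : List (M × ℕ)) : List (M × ℕ) :=
  L.flatMap fun z => z :: if z.2 = 0 then [] else u.map fun v => (z.1 * v, z.2 - 1)

/-- The products of one entry each from exactly `k` of the vectors in `w`; products of fewer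
factors are replaced by zeros. -/
def selectionProducts (k : ℕ) (w : List (List M)) : List M :=
  (w.foldr expand [(1, k)]).map fun z => if z.2 = 0 then z.1 else 0

/-- The products of `K` entries of `a`. -/
def tensorPower : ℕ → List M → List M
  | 0, _ => [1]
  | K + 1, a => a.flatMap fun x => (tensorPower K a).map fun y => x * y

/-- The incidence vector of the word `w`: block `i` holds `c i` ones and `d i` copies of the
`K i`-th tensor power of the vector of selection products of `k i` factors. -/
def incidence {r : ℕ} (c d K k : Fin r → ℕ) (w : List (List M)) : List M :=
  (List.finRange r).flatMap fun i => List.replicate (c i) 1 ++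
    (List.replicate (d i) (tensorPower (K i) (selectionProducts (k i) w))).flatten

theorem foldr_expand_map (φ : M →*₀ M') (w : List (List M)) (k : ℕ) :
    (w.map (List.map φ)).foldr expand [(1, k)] =
      (w.foldr expand [(1, k)]).map fun z => (φ z.1, z.2) := by
  induction w with
  | nil => simp
  | cons u w ih =>
    rw [List.map_cons, List.foldr_cons, List.foldr_cons, ih, expand, expand, List.flatMap_map,
      List.map_flatMap]
    congr 1
    funext z
    by_cases hz : z.2 = 0 <;> simp [hz]

theorem selectionProducts_map (φ : M →*₀ M') (k : ℕ) (w : List (List M)) :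
    selectionProducts k (w.map (List.map φ)) = (selectionProducts k w).map φ := by
  rw [selectionProducts, foldr_expand_map, selectionProducts, List.map_map, List.map_map]
  congr 1
  funext z
  by_cases hz : z.2 = 0 <;> simp [hz]

theorem tensorPower_map (φ : M →*₀ M') (K : ℕ) (a : List M) :
    tensorPower K (a.map φ) = (tensorPower K a).map φ := by
  induction K with
  | zero => simp [tensorPower]
  | succ K ih =>
    rw [tensorPower, ih, tensorPower, List.flatMap_map, List.map_flatMap]
    congr 1
    funext x
    simp

/-- Only 0, 1 and products enter the construction, hence it is natural in the monoid. The
projections and the multiplication ℕ × ℕ → ℕ turn this into a formula for intersections; squaring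
turns it into the fact that all entries are 0 or 1. -/
theorem incidence_map (φ : M →*₀ M') {r : ℕ} (c d K k : Fin r → ℕ) (w : List (List M)) :
    incidence c d K k (w.map (List.map φ)) = (incidence c d K k w).map φ := by
  rw [incidence, incidence, List.map_flatMap]
  congr 1
  funext i
  simp [selectionProducts_map, tensorPower_map]

theorem length_tensorPower (K : ℕ) (a : List M) : (tensorPower K a).length = a.length ^ K := by
  induction K with
  | zero => rfl
  | succ K ih => simp [tensorPower, List.length_flatMap, ih, pow_succ']

/-- The weight `(1 + a * q) ^ z.2` bounds the number of continuations of `z` through `a` further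
letters, so moving one letter from `w` into `a` gives the induction. At `a = 0` every weight is 1
and the sum is the length. -/
theorem sum_foldr_expand_le {q : ℕ} (w : List (List M)) (hw : ∀ u ∈ w, u.length ≤ q)
    (k a : ℕ) : ((w.foldr expand [(1, k)]).map fun z => (1 + a * q) ^ z.2).sum ≤
      (1 + (a + w.length) * q) ^ k := by
  induction w generalizing a with
  | nil => simp
  | cons u w ih =>
    have h1 := ih (fun v hv => hw v (by simp [hv])) (a + 1)
    rw [List.foldr_cons, expand, List.map_flatMap, List.flatMap_def, List.sum_flatten,
      List.map_map]
    refine (List.sum_le_sum fun z _ => ?_).trans (h1.trans (by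
      rw [List.length_cons, add_right_comm, add_assoc a]))
    have hu : u.length ≤ q := hw u (by simp)
    by_cases hz : z.2 = 0
    · simp [hz]
    · obtain ⟨j, hj⟩ := Nat.exists_eq_succ_of_ne_zero hz
      simp only [Function.comp_apply, List.map_cons, List.sum_cons, if_neg hz, List.map_map]
      simp only [Function.comp_def, hj, Nat.succ_eq_add_one, Nat.add_sub_cancel, List.map_const',
        List.sum_replicate, smul_eq_mul]
      calc (1 + a * q) ^ (j + 1) + u.length * (1 + a * q) ^ j
          ≤ (1 + a * q) ^ (j + 1) + q * (1 + a * q) ^ j := by gcongr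
        _ = (1 + a * q) ^ j * (1 + (a + 1) * q) := by ring
        _ ≤ (1 + (a + 1) * q) ^ j * (1 + (a + 1) * q) := by gcongr; omega
        _ = (1 + (a + 1) * q) ^ (j + 1) := by ring

theorem length_foldr_expand_le {q : ℕ} (w : List (List M)) (hw : ∀ u ∈ w, u.length ≤ q)
    (k : ℕ) : (w.foldr expand [(1, k)]).length ≤ (1 + w.length * q) ^ k := by
  simpa using sum_foldr_expand_le w hw k 0

theorem length_selectionProducts_le {q : ℕ} (w : List (List M)) (hw : ∀ u ∈ w, u.length ≤ q)
    (k : ℕ) : (selectionProducts k w).length ≤ (1 + w.length * q) ^ k := by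
  simpa [selectionProducts] using length_foldr_expand_le w hw k

theorem length_incidence {r : ℕ} (c d K k : Fin r → ℕ) (w : List (List M)) :
    (incidence c d K k w).length =
      ∑ i, (c i + d i * (selectionProducts (k i) w).length ^ K i) := by
  rw [incidence, List.length_flatMap, ← Fin.sum_univ_def]
  simp [length_tensorPower]

theorem sum_map_const_mul (x : ℕ) (l : List ℕ) : (l.map fun y => x * y).sum = x * l.sum := by
  simpa using List.sum_map_mul_left l (fun y => y) x

/-- A letter of sum 0 contributes nothing; for a letter of sum 1, using it or not are the two terms
of Pascal's rule, so it raises `a` by one. -/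
theorem sum_foldr_expand (w : List (List ℕ)) (hw : ∀ u ∈ w, u.sum ≤ 1) (k a : ℕ) :
    ((w.foldr expand [(1, k)]).map fun z => z.1 * a.choose z.2).sum =
      (a + (w.map List.sum).sum).choose k := by
  induction w generalizing a with
  | nil => simp
  | cons u w ih =>
    have h1 := ih (fun v hv => hw v (by simp [hv])) (a + u.sum)
    rw [List.map_cons, List.sum_cons, ← add_assoc, ← h1, List.foldr_cons, expand,
      List.map_flatMap, List.flatMap_def, List.sum_flatten, List.map_map]
    congr 2
    funext z
    by_cases hz : z.2 = 0
    · simp [hz]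
    · obtain ⟨j, hj⟩ := Nat.exists_eq_succ_of_ne_zero hz
      simp only [Function.comp_apply, List.map_cons, List.sum_cons, if_neg hz, List.map_map]
      simp only [Function.comp_def, hj, Nat.succ_eq_add_one, Nat.add_sub_cancel,
        List.sum_map_mul_right, sum_map_const_mul]
      have hu : u.sum ≤ 1 := hw u (by simp)
      interval_cases u.sum
      · simp
      · rw [Nat.choose_succ_succ, Nat.succ_eq_add_one]
        ring

/-- This is the case `a = 0` above: `choose 0 z.2` is the indicator of an exhausted budget, just as
unfinished products are replaced by 0. -/
theorem sum_selectionProducts (w : List (List ℕ)) (hw : ∀ u ∈ w, u.sum ≤ 1) (k : ℕ) :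
    (selectionProducts k w).sum = (w.map List.sum).sum.choose k := by
  rw [← zero_add (w.map List.sum).sum, ← sum_foldr_expand w hw k 0, selectionProducts]
  congr 2
  funext z
  by_cases hz : z.2 = 0
  · simp [hz]
  · simp [hz, Nat.choose_eq_zero_of_lt (Nat.pos_of_ne_zero hz)]

theorem sum_tensorPower (K : ℕ) (a : List ℕ) : (tensorPower K a).sum = a.sum ^ K := by
  induction K with
  | zero => simp [tensorPower]
  | succ K ih =>
    rw [tensorPower, List.flatMap_def, List.sum_flatten, List.map_map, pow_succ', ← ih]
    simp only [Function.comp_def, sum_map_const_mul]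
    simpa using List.sum_map_mul_right a (fun y => y) (tensorPower K a).sum

theorem sum_incidence {r : ℕ} (c d K k : Fin r → ℕ) (w : List (List ℕ))
    (hw : ∀ u ∈ w, u.sum ≤ 1) : (incidence c d K k w).sum =
      ∑ i, (c i + d i * (w.map List.sum).sum.choose (k i) ^ K i) := by
  rw [incidence, List.flatMap_def, List.sum_flatten, List.map_map, ← Fin.sum_univ_def]
  simp [sum_tensorPower, sum_selectionProducts w hw]

/-- In ℕ only 0 and 1 are fixed by squaring. Naturality under the squaring homomorphism therefore
passes the bound 1 from the letters to all derived vectors. -/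
theorem le_one_of_map_sq {l : List ℕ}
    (h : l.map (powMonoidWithZeroHom (M₀ := ℕ) two_ne_zero) = l) : ∀ v ∈ l, v ≤ 1 := by
  intro v hv
  have h3 : ∀ x ∈ l, powMonoidWithZeroHom (M₀ := ℕ) two_ne_zero x = id x := by
    rw [← List.map_inj_left, h, List.map_id]
  have h4 : v ^ 2 = v := h3 v hv
  nlinarith

theorem map_sq_of_le_one {l : List ℕ} (h : ∀ v ∈ l, v ≤ 1) :
    l.map (powMonoidWithZeroHom (M₀ := ℕ) two_ne_zero) = l := by
  conv_rhs => rw [← List.map_id l]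
  refine List.map_congr_left fun v hv => ?_
  have := h v hv
  interval_cases v <;> simp

theorem map_map_sq_of_le_one {w : List (List ℕ)} (h : ∀ u ∈ w, ∀ v ∈ u, v ≤ 1) :
    w.map (List.map (powMonoidWithZeroHom (M₀ := ℕ) two_ne_zero)) = w := by
  conv_rhs => rw [← List.map_id w]
  exact List.map_congr_left fun u hu => map_sq_of_le_one (h u hu)

theorem foldr_expand_le_one (k : ℕ) (w : List (List ℕ)) (hw : ∀ u ∈ w, ∀ v ∈ u, v ≤ 1) :
    ∀ z ∈ w.foldr expand [(1, k)], z.1 ≤ 1 := by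
  have h := foldr_expand_map (powMonoidWithZeroHom (M₀ := ℕ) two_ne_zero) w k
  rw [map_map_sq_of_le_one hw] at h
  have h1 := congrArg (List.map Prod.fst) h
  rw [List.map_map] at h1
  intro z hz
  refine le_one_of_map_sq (l := (w.foldr expand [(1, k)]).map Prod.fst) ?_ _
    (List.mem_map_of_mem hz)
  rw [List.map_map]
  exact h1.symm

theorem selectionProducts_le_one (k : ℕ) (w : List (List ℕ))
    (hw : ∀ u ∈ w, ∀ v ∈ u, v ≤ 1) : ∀ v ∈ selectionProducts k w, v ≤ 1 := by
  have h := selectionProducts_map (powMonoidWithZeroHom (M₀ := ℕ) two_ne_zero) k w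
  rw [map_map_sq_of_le_one hw] at h
  exact le_one_of_map_sq h.symm

theorem tensorPower_le_one (K : ℕ) (a : List ℕ) (ha : ∀ v ∈ a, v ≤ 1) :
    ∀ v ∈ tensorPower K a, v ≤ 1 := by
  have h := tensorPower_map (powMonoidWithZeroHom (M₀ := ℕ) two_ne_zero) K a
  rw [map_sq_of_le_one ha] at h
  exact le_one_of_map_sq h.symm

theorem incidence_le_one {r : ℕ} (c d K k : Fin r → ℕ) (w : List (List ℕ))
    (hw : ∀ u ∈ w, ∀ v ∈ u, v ≤ 1) : ∀ v ∈ incidence c d K k w, v ≤ 1 := by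
  have h := incidence_map (powMonoidWithZeroHom (M₀ := ℕ) two_ne_zero) c d K k w
  rw [map_map_sq_of_le_one hw] at h
  exact le_one_of_map_sq h.symm

end incidence

/-! ### Sets as supports of 0/1 vectors. -/

section support

/-- The set of the positions at which `v` is not zero. -/
def supportSet (h : ℕ) (v : List ℕ) : Finset (Fin h) :=
  Finset.univ.filter fun j => v.getD j 0 ≠ 0

theorem sum_getD (h : ℕ) (v : List ℕ) (hv : v.length ≤ h) :
    ∑ j : Fin h, v.getD j 0 = v.sum := by
  induction v generalizing h with
  | nil => simp
  | cons a v ih =>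
    obtain ⟨h, rfl⟩ : ∃ h', h = h' + 1 := ⟨h - 1, by simp at hv; omega⟩
    rw [Fin.sum_univ_succ]
    simp only [Fin.val_zero, List.getD_cons_zero, Fin.val_succ, List.getD_cons_succ,
      List.sum_cons]
    rw [ih h (by simpa using hv)]

theorem getD_le_one {v : List ℕ} (hv : ∀ x ∈ v, x ≤ 1) (j : ℕ) : v.getD j 0 ≤ 1 := by
  rcases lt_or_ge j v.length with h | h
  · rw [List.getD_eq_getElem _ _ h]
    exact hv _ (List.getElem_mem h)
  · rw [List.getD_eq_default _ _ h]
    exact zero_le_one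

theorem card_supportSet {h : ℕ} {v : List ℕ} (hlen : v.length ≤ h) (hv : ∀ x ∈ v, x ≤ 1) :
    (supportSet h v).card = v.sum := by
  rw [← sum_getD h v hlen, supportSet, Finset.card_filter]
  refine Finset.sum_congr rfl fun j _ => ?_
  have := getD_le_one hv j
  split_ifs <;> omega

theorem supportSet_inter (h : ℕ) (V : List (ℕ × ℕ)) :
    supportSet h (V.map Prod.fst) ∩ supportSet h (V.map Prod.snd) =
      supportSet h (V.map fun z => z.1 * z.2) := by
  ext j
  simp only [supportSet, Finset.mem_inter, Finset.mem_filter, Finset.mem_univ, true_and]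
  have h1 : ∀ f : ℕ × ℕ → ℕ, f (0, 0) = 0 →
      (V.map f).getD j 0 = f (V.getD j (0, 0)) := fun f hf => by
    rw [← List.getD_map V (0, 0) f, hf]
  rw [h1 _ rfl, h1 _ rfl, h1 _ rfl, mul_ne_zero_iff]

/-- The vector `v`, filled up with zeros to length `h`. -/
def padded (h : ℕ) (v : List ℕ) : List ℕ := v ++ List.replicate (h - v.length) 0

/-- The unary numbers 0 and 1 are the trees of the two bits, so a 0/1 vector of length `h` is
already in the output format. -/
theorem code_padded {h : ℕ} {v : List ℕ} (hlen : v.length ≤ h) (hv : ∀ x ∈ v, x ≤ 1) :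
    TreeCode.code (padded h v) = Data.ofSet (supportSet h v) := by
  rw [Data.ofSet]
  change Data.ofList _ = _
  congr 1
  refine List.ext_getElem (by simp [padded]; omega) fun j h1 h2 => ?_
  have h3 : (padded h v)[j]'(by simpa using h1) = v.getD j 0 := by
    rw [← List.getD_eq_getElem _ 0, padded]
    rcases lt_or_ge j v.length with h3 | h3
    · rw [List.getD_append _ _ _ _ h3]
    · rw [List.getD_append_right _ _ _ _ h3, List.getD_eq_default _ _ h3,
        List.getD_eq_getElem?_getD,
        List.getElem?_getD_replicate_default_eq]
  simp only [List.getElem_map, h3, List.getElem_finRange, supportSet, Finset.mem_filter,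
    Finset.mem_univ, true_and, Fin.val_cast]
  have := getD_le_one hv j
  interval_cases v.getD j 0 <;> rfl

end support

/-! ### Words and unit vectors. -/

section words

variable {β : Type}

/-- The words of length `n` with letters from `E`. -/
def words (E : List β) : ℕ → List (List β)
  | 0 => [[]]
  | n + 1 => E.flatMap fun u => (words E n).map fun w => u :: w

theorem length_words (E : List β) (n : ℕ) : (words E n).length = E.length ^ n := by
  induction n with
  | zero => rfl
  | succ n ih => simp [words, List.length_flatMap, ih, pow_succ']

theorem mem_words {E : List β} {n : ℕ} {w : List β} :
    w ∈ words E n ↔ w.length = n ∧ ∀ u ∈ w, u ∈ E := by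
  induction n generalizing w with
  | zero => cases w <;> simp [words]
  | succ n ih =>
    simp only [words, List.mem_flatMap, List.mem_map, ih]
    cases w with
    | nil => simp
    | cons a w => simp; tauto

theorem nodup_words {E : List β} (hE : E.Nodup) (n : ℕ) : (words E n).Nodup := by
  induction n with
  | zero => simp [words]
  | succ n ih =>
    rw [words, List.nodup_flatMap]
    refine ⟨fun u _ => ih.map fun a b h => by simpa using h, ?_⟩
    refine hE.imp fun {a b} hab => ?_
    simp [Function.onFun, List.disjoint_left, hab.symm]

/-- The unit vectors of length `q`. -/
def unitVectors (q : ℕ) : List (List ℕ) :=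
  -- With truncated subtraction this is 1 - |i - j|, the Kronecker delta in operations known to be
  -- feasible.
  (List.range q).map fun i => (List.range q).map fun j => 1 - (i - j + (j - i))

theorem unitVectors_inner {q : ℕ} {u v : List ℕ} (hu : u ∈ unitVectors q)
    (hv : v ∈ unitVectors q) :
    (List.zipWith (· * ·) u v).sum = if u = v then 1 else 0 := by
  simp only [unitVectors, List.mem_map, List.mem_range] at hu hv
  obtain ⟨i, hi, rfl⟩ := hu
  obtain ⟨j, hj, rfl⟩ := hv
  rw [List.zipWith_map, List.zipWith_self]
  have h1 : ∀ a b : ℕ, 1 - (a - b + (b - a)) = if a = b then 1 else 0 := by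
    intro a b
    split_ifs <;> omega
  simp only [h1]
  have h2 : ∀ f : ℕ → ℕ, ((List.range q).map f).sum = ∑ a ∈ Finset.range q, f a := fun f => rfl
  rw [h2]
  by_cases hij : i = j
  · subst hij
    simp [hi]
  · have h3 : ¬ (List.map (fun j => if i = j then 1 else 0) (List.range q) =
        List.map (fun j_1 => if j = j_1 then 1 else 0) (List.range q)) := by
      rw [List.map_inj_left]
      intro h
      have := h i (by simpa using hi)
      simp [Ne.symm hij] at this
    rw [if_neg h3]
    refine Finset.sum_eq_zero fun a _ => ?_
    by_cases h : i = a
    · subst h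
      simp [Ne.symm hij]
    · simp [h]

theorem length_unitVectors (q : ℕ) : (unitVectors q).length = q := by simp [unitVectors]

theorem length_of_mem_unitVectors {q : ℕ} {u : List ℕ} (hu : u ∈ unitVectors q) :
    u.length = q := by
  simp only [unitVectors, List.mem_map] at hu
  obtain ⟨i, _, rfl⟩ := hu
  simp

theorem le_one_of_mem_unitVectors {q : ℕ} {u : List ℕ} (hu : u ∈ unitVectors q) :
    ∀ x ∈ u, x ≤ 1 := by
  simp only [unitVectors, List.mem_map] at hu
  obtain ⟨i, _, rfl⟩ := hu
  simp only [List.mem_map]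
  rintro x ⟨j, _, rfl⟩
  omega

theorem nodup_unitVectors (q : ℕ) : (unitVectors q).Nodup := by
  refine List.Nodup.map_on (fun i hi j hj h => ?_) List.nodup_range
  rw [List.map_inj_left] at h
  have := h i hi
  omega

end words

/-! ### Intersections of members and agreements of words. -/

section agreement

/-- The number of agreements of two words of unit vectors, as the sum of the inner products. -/
def agreement (w w' : List (List ℕ)) : ℕ :=
  (List.zipWith (fun u v => (List.zipWith (· * ·) u v).sum) w w').sum

theorem agreement_le {q : ℕ} {w w' : List (List ℕ)} (hw : ∀ u ∈ w, u ∈ unitVectors q)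
    (hw' : ∀ u ∈ w', u ∈ unitVectors q) (hlen : w.length = w'.length) :
    agreement w w' ≤ w.length ∧ (agreement w w' = w.length ↔ w = w') := by
  induction w generalizing w' with
  | nil => cases w' <;> simp_all [agreement]
  | cons u w ih =>
    cases w' with
    | nil => simp at hlen
    | cons v w' =>
      have h1 := ih (fun x hx => hw x (by simp [hx])) (w' := w')
        (fun x hx => hw' x (by simp [hx])) (by simpa using hlen)
      have h2 := unitVectors_inner (hw u (by simp)) (hw' v (by simp))
      simp only [agreement, List.zipWith_cons_cons, List.sum_cons, List.length_cons,
        List.cons.injEq] at h1 h2 ⊢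
      rw [h2]
      split_ifs with h
      · simp only [h, true_and]
        rw [← h1.2]
        omega
      · simp only [h, false_and, iff_false]
        omega

theorem map_zipWith_zip {β : Type} {w w' : List (List β)} (hlen : w.length = w'.length)
    (h : ∀ u ∈ w, ∀ v ∈ w', u.length = v.length) :
    (List.zipWith List.zip w w').map (List.map Prod.fst) = w ∧
      (List.zipWith List.zip w w').map (List.map Prod.snd) = w' := by
  induction w generalizing w' with
  | nil => cases w' <;> simp_all
  | cons u w ih =>
    cases w' with
    | nil => simp at hlen
    | cons v w' =>
      have h1 := ih (w' := w') (by simpa using hlen) fun a ha b hb =>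
        h a (by simp [ha]) b (by simp [hb])
      have h2 := h u (by simp) v (by simp)
      simp only [List.zipWith_cons_cons, List.map_cons, h1.1, h1.2]
      rw [List.map_fst_zip h2.le, List.map_snd_zip h2.ge]
      exact ⟨rfl, rfl⟩

/-- Zip the two words into one word `W` over ℕ × ℕ. By naturality both incidence vectors are
projections of that of `W`, and the intersection belongs to the letterwise product word. Its letters
are unit vectors where the words agree and zero vectors elsewhere, so the letter sums add up to the
number of agreements. -/
theorem card_inter_supportSet {r : ℕ} (c d K k : Fin r → ℕ) {h q : ℕ} {w w' : List (List ℕ)}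
    (hw : ∀ u ∈ w, u ∈ unitVectors q) (hw' : ∀ u ∈ w', u ∈ unitVectors q)
    (hlen : w.length = w'.length) (hh : (incidence c d K k w).length ≤ h) :
    (supportSet h (incidence c d K k w) ∩ supportSet h (incidence c d K k w')).card =
      ∑ i, (c i + d i * (agreement w w').choose (k i) ^ K i) := by
  have hz := map_zipWith_zip hlen fun u hu v hv =>
    (length_of_mem_unitVectors (hw u hu)).trans (length_of_mem_unitVectors (hw' v hv)).symm
  set W : List (List (ℕ × ℕ)) := List.zipWith List.zip w w' with hW
  have h1 := incidence_map (RingHom.fst ℕ ℕ).toMonoidWithZeroHom c d K k W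
  have h2 := incidence_map (RingHom.snd ℕ ℕ).toMonoidWithZeroHom c d K k W
  have h3 := incidence_map (mulMonoidWithZeroHom (M₀ := ℕ)) c d K k W
  change incidence c d K k (W.map (List.map Prod.fst)) = List.map Prod.fst _ at h1
  change incidence c d K k (W.map (List.map Prod.snd)) = List.map Prod.snd _ at h2
  change incidence c d K k (W.map (List.map fun z : ℕ × ℕ => z.1 * z.2)) =
    List.map (fun z : ℕ × ℕ => z.1 * z.2) _ at h3
  rw [hz.1] at h1
  rw [hz.2] at h2
  have h4 : W.map (List.map fun z : ℕ × ℕ => z.1 * z.2) =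
      List.zipWith (List.zipWith (· * ·)) w w' := by
    rw [hW, List.map_zipWith]
    congr 1
    funext u v
    rw [List.zip, List.map_zipWith]
  have h5 : ∀ x ∈ List.zipWith (List.zipWith (· * ·)) w w', ∃ u ∈ w, ∃ v ∈ w',
      x = List.zipWith (· * ·) u v := by
    intro x hx
    rw [← List.map_uncurry_zip_eq_zipWith, List.mem_map] at hx
    obtain ⟨⟨u, v⟩, huv, rfl⟩ := hx
    exact ⟨u, (List.of_mem_zip huv).1, v, (List.of_mem_zip huv).2, rfl⟩
  rw [h1, h2, supportSet_inter, ← h3, h4, card_supportSet, sum_incidence]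
  · rw [List.map_zipWith]
    rfl
  · intro x hx
    obtain ⟨u, hu, v, hv, rfl⟩ := h5 x hx
    rw [unitVectors_inner (hw u hu) (hw' v hv)]
    split_ifs <;> omega
  · rw [← h4, h3]
    simpa [h1] using hh
  · refine incidence_le_one _ _ _ _ _ fun x hx y hy => ?_
    obtain ⟨u, hu, v, hv, rfl⟩ := h5 x hx
    rw [← List.map_uncurry_zip_eq_zipWith, List.mem_map] at hy
    obtain ⟨⟨a, b⟩, hab, rfl⟩ := hy
    exact Nat.mul_le_mul (le_one_of_mem_unitVectors (hw u hu) _ (List.of_mem_zip hab).1)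
      (le_one_of_mem_unitVectors (hw' v hv) _ (List.of_mem_zip hab).2)

end agreement

/-! ### Residues of the intersection sizes. -/

section residues

/-- In (a + 1) C(a, p^e - 1) = p^e C(a + 1, p^e), a binomial coefficient prime to p on the left
would force p^e to divide a + 1. -/
theorem dvd_choose_of_not_dvd {p e a : ℕ} (hp : p.Prime) (h : ¬ p ^ e ∣ a + 1) :
    p ∣ a.choose (p ^ e - 1) := by
  by_contra hc
  refine h (((hp.coprime_iff_not_dvd.2 hc).pow_left e).dvd_of_dvd_mul_right ?_)
  have h1 := Nat.add_one_mul_choose_eq a (p ^ e - 1)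
  rw [Nat.sub_add_cancel (Nat.one_le_pow _ _ hp.pos)] at h1
  rw [h1]
  exact Dvd.intro_left _ rfl

/-- Lucas: the last e base-p digits of p^e M - 1 are all p - 1, as are those of p^e - 1, so each
digit contributes C(p - 1, p - 1) = 1. -/
theorem choose_prime_pow_sub_one_modEq {p : ℕ} (hp : p.Prime) (e M : ℕ) (hM : 0 < M) :
    (p ^ e * M - 1).choose (p ^ e - 1) ≡ 1 [MOD p] := by
  have := Fact.mk hp
  induction e with
  | zero => simp [Nat.ModEq]
  | succ e ih =>
    have key : ∀ a, 0 < a → (p * a - 1) % p = p - 1 ∧ (p * a - 1) / p = a - 1 := by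
      intro a ha
      obtain ⟨a, rfl⟩ : ∃ b, a = b + 1 := ⟨a - 1, by omega⟩
      have h1 : p * (a + 1) - 1 = (p - 1) + p * a := by
        have := hp.pos
        rw [mul_add]
        omega
      have h2 : p - 1 < p := Nat.sub_lt hp.pos one_pos
      rw [h1, Nat.add_mul_mod_self_left, Nat.add_mul_div_left _ _ hp.pos, Nat.mod_eq_of_lt h2,
        Nat.div_eq_of_lt h2]
      simp
    have hpe : 0 < p ^ e := Nat.pow_pos hp.pos
    have h1 := Choose.choose_modEq_choose_mod_mul_choose_div_nat (p := p)
      (n := p ^ (e + 1) * M - 1) (k := p ^ (e + 1) - 1)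
    rw [pow_succ', mul_assoc, (key _ (Nat.mul_pos hpe hM)).1, (key _ (Nat.mul_pos hpe hM)).2,
      (key _ hpe).1, (key _ hpe).2, Nat.choose_self, one_mul] at h1
    rw [pow_succ', mul_assoc]
    exact h1.trans ih

/-- The factor α in the exponent kills multiples of p, the totient sends units to 1 by Euler. -/
theorem pow_modEq_zero_or_one {p α : ℕ} (hp : p.Prime) (a : ℕ) :
    (p ∣ a → a ^ (α * (p ^ α).totient) ≡ 0 [MOD p ^ α]) ∧
      (¬ p ∣ a → a ^ (α * (p ^ α).totient) ≡ 1 [MOD p ^ α]) := by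
  constructor
  · intro h
    rw [Nat.modEq_zero_iff_dvd]
    exact (pow_dvd_pow_of_dvd h α).trans (pow_dvd_pow a
      (Nat.le_mul_of_pos_right α (Nat.totient_pos.2 (Nat.pow_pos hp.pos))))
  · intro h
    rw [mul_comm, pow_mul]
    simpa using (Nat.ModEq.pow_totient
      (((hp.coprime_iff_not_dvd.2 h).pow_left α).symm)).pow α

variable {r : ℕ} (p α : Fin r → ℕ)

/-- A number that is 1 modulo `p i ^ α i` and 0 modulo the other prime powers. -/
def idempotentResidue (i : Fin r) : ℕ :=
  (∏ j ∈ Finset.univ.erase i, p j ^ α j) ^ (p i ^ α i).totient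

/-- The intersection size of two members, as a function of the number `a` of agreements. -/
def intersectionSize (k : Fin r → ℕ) (a : ℕ) : ℕ :=
  ∑ i, (idempotentResidue p α i + idempotentResidue p α i * (p i ^ α i - 1) *
    a.choose (k i) ^ (α i * (p i ^ α i).totient))

variable {p α}

theorem idempotentResidue_pos (hp : ∀ i, (p i).Prime) (i : Fin r) :
    0 < idempotentResidue p α i :=
  Nat.pow_pos (Finset.prod_pos fun j _ => Nat.pow_pos (hp j).pos)

theorem idempotentResidue_modEq_one (hp : ∀ i, (p i).Prime) (hpinj : Function.Injective p)
    (i : Fin r) : idempotentResidue p α i ≡ 1 [MOD p i ^ α i] := by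
  refine Nat.ModEq.pow_totient (Nat.Coprime.prod_left fun j hj => ?_)
  exact ((Nat.coprime_primes (hp j) (hp i)).2 fun h => (Finset.ne_of_mem_erase hj)
    (hpinj h)).pow _ _

theorem dvd_idempotentResidue (hp : ∀ i, (p i).Prime) {i j : Fin r} (hij : j ≠ i) :
    p i ^ α i ∣ idempotentResidue p α j := by
  refine (Finset.dvd_prod_of_mem (fun i => p i ^ α i) (Finset.mem_erase.2
    ⟨hij.symm, Finset.mem_univ i⟩)).trans (dvd_pow_self _ ?_)
  exact (Nat.totient_pos.2 (Nat.pow_pos (hp j).pos)).ne'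

theorem intersectionSize_modEq (hp : ∀ i, (p i).Prime) (hpinj : Function.Injective p)
    (k : Fin r → ℕ) (a : ℕ) (i : Fin r) :
    intersectionSize p α k a ≡ 1 + (p i ^ α i - 1) *
      a.choose (k i) ^ (α i * (p i ^ α i).totient) [MOD p i ^ α i] := by
  rw [intersectionSize, ← Finset.add_sum_erase _ _ (Finset.mem_univ i)]
  have h1 := idempotentResidue_modEq_one (α := α) hp hpinj i
  have h2 : ∑ j ∈ Finset.univ.erase i, (idempotentResidue p α j + idempotentResidue p α j *
      (p j ^ α j - 1) * a.choose (k j) ^ (α j * (p j ^ α j).totient)) ≡ 0 [MOD p i ^ α i] := by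
    rw [Nat.modEq_zero_iff_dvd]
    refine Finset.dvd_sum fun j hj => ?_
    have h3 := dvd_idempotentResidue (α := α) hp (Finset.ne_of_mem_erase hj)
    rw [mul_assoc]
    exact dvd_add h3 (Dvd.dvd.mul_right h3 _)
  simpa using (h1.add ((h1.mul_right _).mul_right _)).add h2

/-- The coefficient `p i ^ α i - 1` stands for -1 while keeping the number of copies nonnegative, so
the residue is 1 - x with x ∈ {0, 1}. -/
theorem intersectionSize_mod (hp : ∀ i, (p i).Prime) (hpinj : Function.Injective p)
    (hα : ∀ i, 0 < α i) (k : Fin r → ℕ) (a : ℕ) (i : Fin r) :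
    intersectionSize p α k a % p i ^ α i = if p i ∣ a.choose (k i) then 1 else 0 := by
  have h1 := intersectionSize_modEq (α := α) hp hpinj k a i
  have h2 := pow_modEq_zero_or_one (α := α i) (hp i) (a.choose (k i))
  have h3 : 1 < p i ^ α i := Nat.one_lt_pow (hα i).ne' (hp i).one_lt
  split_ifs with h
  · have h4 := h1.trans (((h2.1 h).mul_left _).add_left 1)
    rw [mul_zero, add_zero] at h4
    exact Eq.trans h4 (Nat.mod_eq_of_lt h3)
  · have h4 := h1.trans (((h2.2 h).mul_left _).add_left 1)
    rw [mul_one, Nat.add_sub_cancel' h3.le] at h4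
    exact Eq.trans h4 (Nat.mod_self _)

theorem prod_prime_pow_dvd (hp : ∀ i, (p i).Prime) (hpinj : Function.Injective p)
    {e : Fin r → ℕ} {a : ℕ} (h : ∀ i, p i ^ e i ∣ a) : ∏ i, p i ^ e i ∣ a :=
  Fintype.prod_dvd_of_isRelPrime (fun i j hij => Nat.coprime_iff_isRelPrime.1
    (((Nat.coprime_primes (hp i) (hp j)).2 fun h => hij (hpinj h)).pow _ _)) h

theorem intersectionSize_mod_prod (hp : ∀ i, (p i).Prime) (hpinj : Function.Injective p)
    (hα : ∀ i, 0 < α i) {e : Fin r → ℕ} {a : ℕ} (ha : a ≤ ∏ i, p i ^ e i - 1) :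
    intersectionSize p α (fun i => p i ^ e i - 1) a % ∏ i, p i ^ α i = 0 ↔
      a = ∏ i, p i ^ e i - 1 := by
  have hN : 0 < ∏ i, p i ^ e i := Finset.prod_pos fun i _ => Nat.pow_pos (hp i).pos
  constructor
  · intro h
    have h1 : ∏ i, p i ^ e i ∣ a + 1 := by
      refine prod_prime_pow_dvd hp hpinj fun i => ?_
      by_contra hi
      have h2 := intersectionSize_mod (α := α) hp hpinj hα (fun i => p i ^ e i - 1) a i
      rw [if_pos (dvd_choose_of_not_dvd (hp i) hi), Nat.mod_eq_zero_of_dvd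
        ((Finset.dvd_prod_of_mem (fun i => p i ^ α i) (Finset.mem_univ i)).trans
        (Nat.dvd_of_mod_eq_zero h))] at h2
      exact zero_ne_one h2
    have := Nat.le_of_dvd (Nat.succ_pos a) h1
    omega
  · rintro rfl
    refine Nat.mod_eq_zero_of_dvd (prod_prime_pow_dvd hp hpinj fun i => ?_)
    refine Nat.dvd_of_mod_eq_zero ((intersectionSize_mod (α := α) hp hpinj hα _ _ i).trans
      (if_neg ?_))
    intro h
    have h1 := choose_prime_pow_sub_one_modEq (hp i) (e i)
      (∏ j ∈ Finset.univ.erase i, p j ^ e j) (Finset.prod_pos fun j _ => Nat.pow_pos (hp j).pos)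
    rw [Finset.mul_prod_erase _ (fun i => p i ^ e i) (Finset.mem_univ i)] at h1
    have h2 := h1.symm.trans ((Nat.modEq_zero_iff_dvd).2 h)
    exact (hp i).one_lt.ne' (Nat.dvd_one.1 ((Nat.modEq_zero_iff_dvd).1 h2))

end residues

/-! ### Feasibility of the incidence vectors. -/

namespace Feasible

variable {ι α β : Type} [TreeCode α] [TreeCode β] {B : ι → ℕ} {x : ι → α}

/-- Numbers are coded in unary, so besides the lengths the entries must stay bounded for
multiplication to be cheap. -/
theorem expand {u : ι → List ℕ} {L : ι → List (ℕ × ℕ)} (hu : Feasible B x u)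
    (hulen : PolyBounded B fun i => (u i).length) (hu1 : ∀ i, ∀ v ∈ u i, v ≤ 1)
    (hL : Feasible B x L) (hLlen : PolyBounded B fun i => (L i).length)
    (hL1 : ∀ i, ∀ z ∈ L i, z.1 ≤ 1) : Feasible B x fun i => expand (u i) (L i) := by
  refine flatMap hL hLlen (id.snd.cons (ite id.snd.snd (const []) (map ?_ ?_ ?_))) ?_
  · exact hu.lift (fun j => j.1.1) id.fst
  · exact hulen.reindex fun j => j.1.1
  · refine pair (mul id.fst.snd.fst id.snd ?_ ?_) id.fst.snd.snd.pred
    · exact (PolyBounded.const 1).mono fun j => hL1 _ _ j.1.1.2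
    · exact (PolyBounded.const 1).mono fun j => hu1 _ _ j.2
  · refine (((hulen.reindex fun j => j.1.1).add (PolyBounded.const 1))).mono fun j => ?_
    split_ifs <;> simp

theorem selectionProducts {w : ι → List (List ℕ)} {k q : ι → ℕ} (hw : Feasible B x w)
    (hwlen : PolyBounded B fun i => (w i).length) (hq : PolyBounded B q)
    (hwq : ∀ i, ∀ u ∈ w i, u.length ≤ q i) (hw1 : ∀ i, ∀ u ∈ w i, ∀ v ∈ u, v ≤ 1)
    (hk : Feasible B x k) (hS : PolyBounded B fun i => (1 + (w i).length * q i) ^ k i) :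
    Feasible B x fun i => selectionProducts (k i) (w i) := by
  refine map (foldr hw hwlen (((const 1).pair hk).cons (const [])) (expand id.snd ?_ ?_
    id.fst.snd ?_ ?_)) ?_ (ite id.snd.snd id.snd.fst (const 0))
  · exact (hq.reindex fun j => j.1.1).mono fun j => hwq _ _ (j.2.subset (by simp))
  · exact fun j => hw1 _ _ (j.2.subset (by simp))
  · refine (hS.reindex fun j => j.1.1).mono fun j => ?_
    have h1 : j.1.2.2 <:+ w j.1.1 := (List.suffix_cons _ _).trans j.2
    refine (length_foldr_expand_le j.1.2.2 (fun u hu => hwq j.1.1 u (h1.subset hu)) _).trans ?_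
    gcongr
    exact h1.length_le
  · intro j
    have h1 : j.1.2.2 <:+ w j.1.1 := (List.suffix_cons _ _).trans j.2
    exact foldr_expand_le_one _ _ fun u hu => hw1 _ _ (h1.subset hu)
  · exact hS.mono fun i => length_foldr_expand_le _ (hwq i) _

theorem tensorPower {a : ι → List ℕ} (ha : Feasible B x a)
    (halen : PolyBounded B fun i => (a i).length) (ha1 : ∀ i, ∀ v ∈ a i, v ≤ 1) (K : ℕ) :
    Feasible B x fun i => tensorPower K (a i) := by
  have hlen : ∀ K, PolyBounded B fun i => (_root_.tensorPower K (a i)).length := fun K =>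
    (halen.pow K).mono fun i => (length_tensorPower K _).le
  induction K with
  | zero => exact const [1]
  | succ K ih =>
    refine flatMap ha halen (map ?_ ?_ (mul id.fst.snd id.snd ?_ ?_)) ?_
    · exact ih.lift (fun j => j.1.1) id.fst
    · exact (hlen K).reindex fun j => j.1.1
    · exact (PolyBounded.const 1).mono fun j => ha1 _ _ j.1.1.2
    · exact (PolyBounded.const 1).mono fun j => tensorPower_le_one K _ (ha1 _) _ j.2
    · exact ((hlen K).reindex fun j => j.1.1).mono fun j => by simp

theorem flattenReplicate {l : ι → List β} (hl : Feasible B x l)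
    (hlen : PolyBounded B fun i => (l i).length) (c : ℕ) :
    Feasible B x fun i => (List.replicate c (l i)).flatten := by
  induction c with
  | zero => exact const []
  | succ c ih => simpa only [List.replicate_succ, List.flatten_cons] using hl.append ih hlen

theorem incidence {r : ℕ} (c d K : Fin r → ℕ) {w : ι → List (List ℕ)} {k : Fin r → ι → ℕ}
    {q : ι → ℕ} (hw : Feasible B x w) (hwlen : PolyBounded B fun i => (w i).length)
    (hq : PolyBounded B q) (hwq : ∀ i, ∀ u ∈ w i, u.length ≤ q i)
    (hw1 : ∀ i, ∀ u ∈ w i, ∀ v ∈ u, v ≤ 1) (hk : ∀ t, Feasible B x (k t))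
    (hS : ∀ t, PolyBounded B fun i => (1 + (w i).length * q i) ^ k t i) :
    Feasible B x fun i => incidence c d K (fun t => k t i) (w i) := by
  have hsel : ∀ t, PolyBounded B fun i => (_root_.selectionProducts (k t i) (w i)).length :=
    fun t => (hS t).mono fun i => length_selectionProducts_le _ (hwq i) _
  have hten : ∀ t, PolyBounded B fun i =>
      (_root_.tensorPower (K t) (_root_.selectionProducts (k t i) (w i))).length :=
    fun t => ((hsel t).pow (K t)).mono fun i => (length_tensorPower _ _).le
  refine constFlatMap (List.finRange r) (fun t => ?_) fun t => ?_
  · refine append (const _) (flattenReplicate ?_ (hten t) (d t)) ?_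
    · exact tensorPower (selectionProducts hw hwlen hq hwq hw1 (hk t) (hS t)) (hsel t)
        (fun i => selectionProducts_le_one _ _ (hw1 i)) (K t)
    · exact (PolyBounded.const (c t)).mono fun i => by simp
  · refine ((PolyBounded.const (c t)).add ((PolyBounded.const (d t)).mul (hten t))).mono
      fun i => by simp

theorem words {E : ι → List β} {n : ι → ℕ} (hE : Feasible B x E)
    (hElen : PolyBounded B fun i => (E i).length) (hE0 : ∀ i, 0 < (E i).length)
    (hn : Feasible B x n) (hnlen : PolyBounded B n)
    (hpow : PolyBounded B fun i => (E i).length ^ n i) :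
    Feasible B x fun i => words (E i) (n i) := by
  have hlen : PolyBounded (ι := {j : ι × ℕ // j.2 < n j.1}) (fun j => B j.1.1)
      fun j => (_root_.words (E j.1.1) j.1.2).length :=
    (hpow.reindex fun j => j.1.1).mono fun j =>
      (length_words _ _).trans_le (Nat.pow_le_pow_right (hE0 _) j.2.le)
  refine natRec (s := fun i k => _root_.words (E i) k) hn hnlen (const [[]]) ?_
  refine flatMap (hE.lift (fun j => j.1.1) id.fst) (hElen.reindex fun j => j.1.1)
    (map id.fst.snd ?_ (id.fst.snd.cons id.snd)) ?_
  · exact hlen.reindex fun j => j.1.1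
  · exact (hlen.reindex fun j => j.1.1).mono fun j => by simp

theorem unitVectors {q : ι → ℕ} (hq : Feasible B x q) (hqlen : PolyBounded B q) :
    Feasible B x fun i => unitVectors (q i) := by
  have hr := range hq hqlen
  refine map hr (hqlen.mono fun i => by simp) (map (hr.lift (fun j => j.1.1) id.fst) ?_ ?_)
  · exact (hqlen.reindex fun j => j.1.1).mono fun j => by simp
  · have h1 : PolyBounded (ι := {j' : {j : ι × ℕ // j.2 ∈ List.range (q j.1)} × ℕ //
        j'.2 ∈ List.range (q j'.1.1.1)}) (fun j' => B j'.1.1.1.1) fun j' => j'.1.1.1.2 :=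
      (hqlen.reindex fun j => j.1.1.1.1).mono fun j => (List.mem_range.1 j.1.1.2).le
    have h2 : PolyBounded (ι := {j' : {j : ι × ℕ // j.2 ∈ List.range (q j.1)} × ℕ //
        j'.2 ∈ List.range (q j'.1.1.1)}) (fun j' => B j'.1.1.1.1) fun j' => j'.1.2 :=
      (hqlen.reindex fun j => j.1.1.1.1).mono fun j => (List.mem_range.1 j.2).le
    have hi := (id (B := fun j' : {j' : {j : ι × ℕ // j.2 ∈ List.range (q j.1)} × ℕ //
        j'.2 ∈ List.range (q j'.1.1.1)} => B j'.1.1.1.1)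
        (x := fun j' => ((x j'.1.1.1.1, j'.1.1.1.2), j'.1.2))).fst.snd
    exact (const 1).sub ((id.fst.snd.sub id.snd h2).add (id.snd.sub id.fst.snd h1)
      (h2.mono fun j => Nat.sub_le _ _))
      ((h1.add h2).mono fun j => by omega)

theorem padded {h : ι → ℕ} {v : ι → List ℕ} (hh : Feasible B x h) (hhlen : PolyBounded B h)
    (hv : Feasible B x v) (hvlen : PolyBounded B fun i => (v i).length) :
    Feasible B x fun i => padded (h i) (v i) :=
  hv.append (replicate (hh.sub (hv.length hvlen) hvlen) (hhlen.mono fun _ => Nat.sub_le _ _)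
    (const 0)) hvlen

end Feasible

/-! ### Choice of parameters and estimates. -/

section parameters

theorem mul_succ_le_two_pow (D a : ℕ) (ha : 2 * D + 3 ≤ a) : D * (a + 1) ≤ 2 ^ a := by
  induction a, ha using Nat.le_induction with
  | base =>
    have h1 : D + 1 < 2 ^ (D + 1) := Nat.lt_two_pow_self
    have h2 : 2 ^ (2 * D + 3) = 2 * (2 ^ (D + 1) * 2 ^ (D + 1)) := by
      rw [← pow_add, ← pow_succ']
      congr 1
      ring
    have h3 : (D + 2) * (D + 2) ≤ 2 ^ (D + 1) * 2 ^ (D + 1) := Nat.mul_le_mul h1 h1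
    rw [h2]
    nlinarith
  | succ a ha ih =>
    rw [pow_succ]
    nlinarith [Nat.zero_le (D * a)]

theorem mul_log_log_le (D h : ℕ) (hh : 2 ^ 2 ^ (2 * D + 3) ≤ h) :
    D * (Nat.log 2 (Nat.log 2 h) + 1) ≤ Nat.log 2 h := by
  have h1 : 2 ^ (2 * D + 3) ≤ Nat.log 2 h :=
    Nat.le_log_of_pow_le one_lt_two hh
  have h2 : 2 * D + 3 ≤ Nat.log 2 (Nat.log 2 h) := Nat.le_log_of_pow_le one_lt_two h1
  refine (mul_succ_le_two_pow D _ h2).trans (Nat.pow_log_le_self 2 ?_)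
  have := Nat.pow_pos (n := 2 * D + 3) (zero_lt_two (α := ℕ))
  omega

/-- The scale for the prime powers. -/
def scale (A h : ℕ) : ℕ := Nat.log 2 h / (A * (Nat.log 2 (Nat.log 2 h) + 1))

variable {r : ℕ} (p : Fin r → ℕ) (A : ℕ)

/-- The exponent of the largest power of `p i` up to the scale. -/
def exponent (h : ℕ) (i : Fin r) : ℕ := Nat.log (p i) (scale A h)

/-- The length of the words. -/
def wordLength (h : ℕ) : ℕ := ∏ i, p i ^ exponent p A h i - 1

variable {p A} {h : ℕ}

theorem pow_exponent_mul_le (hs : 0 < scale A h) (i : Fin r) :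
    p i ^ exponent p A h i * (A * (Nat.log 2 (Nat.log 2 h) + 1)) ≤ Nat.log 2 h :=
  (Nat.mul_le_mul_right _ (Nat.pow_log_le_self _ hs.ne')).trans (Nat.div_mul_le_self _ _)

theorem pow_exponent_le (hs : 0 < scale A h) (i : Fin r) :
    p i ^ exponent p A h i ≤ Nat.log 2 h :=
  (Nat.pow_log_le_self _ hs.ne').trans (Nat.div_le_self _ _)

theorem wordLength_add_one (hp : ∀ i, (p i).Prime) :
    wordLength p A h + 1 = ∏ i, p i ^ exponent p A h i :=
  Nat.sub_add_cancel (Finset.prod_pos fun i _ => Nat.pow_pos (hp i).pos)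

/-- With l = log₂ h rounded down and lam = log₂ l + 1, the base is at most l^(r+1) ≤ 2^((r+1) lam).
The total exponent of 2 is then at most k A lam, and `scale` was defined to make this at most l. The
square reserves a factor √h for the copies. -/
theorem selection_pow_sq_le (hp : ∀ i, (p i).Prime) (hh : h ≠ 0) (hs : 0 < scale A h)
    {K : ℕ} (hK : 2 * (r + 1) * K ≤ A) (i : Fin r) :
    ((1 + wordLength p A h * Nat.log 2 h) ^ (p i ^ exponent p A h i - 1)) ^ K *
      ((1 + wordLength p A h * Nat.log 2 h) ^ (p i ^ exponent p A h i - 1)) ^ K ≤ h := by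
  set l := Nat.log 2 h with hl
  set lam := Nat.log 2 l + 1 with hlam
  have hl0 : 0 < l := lt_of_lt_of_le (Nat.pow_pos (hp i).pos) (pow_exponent_le hs i)
  have h1 : 1 + wordLength p A h * l ≤ l ^ (r + 1) := by
    calc 1 + wordLength p A h * l ≤ (wordLength p A h + 1) * l := by rw [add_mul]; omega
      _ = (∏ i, p i ^ exponent p A h i) * l := by rw [wordLength_add_one hp]
      _ ≤ l ^ r * l := by
        gcongr
        simpa using Finset.prod_le_prod' (s := Finset.univ)
          fun i _ => pow_exponent_le (p := p) hs i
      _ = l ^ (r + 1) := (pow_succ _ _).symm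
  have h2 : l ≤ 2 ^ lam := (Nat.lt_pow_succ_log_self one_lt_two l).le
  have h3 := pow_exponent_mul_le (p := p) hs i
  set k := p i ^ exponent p A h i - 1 with hk
  calc _ = (1 + wordLength p A h * l) ^ (2 * (k * K)) := by
        rw [← pow_mul, ← pow_add, two_mul]
    _ ≤ ((2 ^ lam) ^ (r + 1)) ^ (2 * (k * K)) := by gcongr; exact h1.trans (by gcongr)
    _ = 2 ^ (k * (2 * (r + 1) * K * lam)) := by
        rw [← pow_mul, ← pow_mul]
        congr 1
        ring
    _ ≤ 2 ^ l := by
        refine Nat.pow_le_pow_right two_pos (le_trans ?_ h3)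
        gcongr
        omega
    _ ≤ h := Nat.pow_log_le_self 2 hh

theorem length_incidence_le (hp : ∀ i, (p i).Prime) (hs : 0 < scale A h)
    {c d K : Fin r → ℕ} (hK : ∀ i, 2 * (r + 1) * K i ≤ A)
    (hh : (∑ i, (c i + d i)) * ∑ i, (c i + d i) ≤ h) (hh0 : h ≠ 0) {w : List (List ℕ)}
    (hw : w ∈ words (unitVectors (Nat.log 2 h)) (wordLength p A h)) :
    (incidence c d K (fun i => p i ^ exponent p A h i - 1) w).length ≤ h := by
  rw [mem_words] at hw
  have h0 : 1 ≤ Nat.sqrt h := Nat.sqrt_pos.2 (Nat.pos_of_ne_zero hh0)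
  have h1 : ∀ i, (selectionProducts (p i ^ exponent p A h i - 1) w).length ^ K i ≤
      Nat.sqrt h := fun i => by
    rw [Nat.le_sqrt]
    refine le_trans ?_ (selection_pow_sq_le hp hh0 hs (hK i) i)
    have := length_selectionProducts_le w
      (fun u hu => (length_of_mem_unitVectors (hw.2 u hu)).le) (p i ^ exponent p A h i - 1)
    rw [hw.1] at this
    gcongr
  rw [length_incidence]
  calc _ ≤ ∑ i, (c i + d i) * Nat.sqrt h := Finset.sum_le_sum fun i _ => by
        rw [add_mul]
        exact add_le_add (Nat.le_mul_of_pos_right _ h0) (Nat.mul_le_mul_left _ (h1 i))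
    _ = (∑ i, (c i + d i)) * Nat.sqrt h := (Finset.sum_mul _ _ _).symm
    _ ≤ Nat.sqrt h * Nat.sqrt h := Nat.mul_le_mul_right _ (Nat.le_sqrt.2 hh)
    _ ≤ h := Nat.sqrt_le h

/-- By maximality of the exponent, `p i ^ exponent p A h i` falls short of the scale by less than a
factor `p i`; multiply over `i`. -/
theorem le_mul_wordLength (hp : ∀ i, (p i).Prime) (hr : 0 < r) (hA : 0 < A)
    (hs : ∀ i, p i ≤ scale A h) :
    Nat.log 2 h ^ r ≤ (∏ i, p i) * (A * (Nat.log 2 (Nat.log 2 h) + 1)) ^ r *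
      (2 * wordLength p A h) := by
  have h1 : ∀ i, Nat.log 2 h ≤
      p i ^ exponent p A h i * (p i * (A * (Nat.log 2 (Nat.log 2 h) + 1))) := fun i => by
    have := Nat.lt_pow_succ_log_self (hp i).one_lt (scale A h)
    rw [scale, Nat.div_lt_iff_lt_mul (by positivity)] at this
    rw [← mul_assoc, ← pow_succ]
    exact this.le
  -- This absorbs the -1 in the word length at the cost of a factor 2.
  have h2 : 2 ≤ ∏ i, p i ^ exponent p A h i := by
    let i : Fin r := ⟨0, hr⟩
    have h3 : 2 ≤ p i ^ exponent p A h i := by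
      have : 1 ≤ exponent p A h i := Nat.le_log_of_pow_le (hp i).one_lt (by simpa using hs i)
      calc 2 ≤ p i ^ 1 := by simpa using (hp i).two_le
        _ ≤ _ := Nat.pow_le_pow_right (hp i).pos this
    exact h3.trans (Nat.le_of_dvd (Finset.prod_pos fun i _ => Nat.pow_pos (hp i).pos)
      (Finset.dvd_prod_of_mem (fun i => p i ^ exponent p A h i) (Finset.mem_univ i)))
  have h3 : ∏ i, p i ^ exponent p A h i ≤ 2 * wordLength p A h := by
    have := wordLength_add_one (A := A) (h := h) hp
    omega
  calc Nat.log 2 h ^ r = ∏ _i : Fin r, Nat.log 2 h := by simp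
    _ ≤ ∏ i, (p i ^ exponent p A h i * (p i * (A * (Nat.log 2 (Nat.log 2 h) + 1)))) :=
      Finset.prod_le_prod' fun i _ => h1 i
    _ = (∏ i, p i) * (A * (Nat.log 2 (Nat.log 2 h) + 1)) ^ r *
        ∏ i, p i ^ exponent p A h i := by
      rw [Finset.prod_mul_distrib, Finset.prod_mul_distrib]
      simp only [Finset.prod_const, Finset.card_univ, Fintype.card_fin]
      ring
    _ ≤ _ := Nat.mul_le_mul_left _ h3

theorem log_pow_div_le (hp : ∀ i, (p i).Prime) (hr : 0 < r) (hA : 0 < A)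
    (hs : ∀ i, p i ≤ scale A h) (hl : 4 ≤ Nat.log 2 h) :
    1.5 * Real.log h ^ r / Real.log (Real.log h) ^ (r - 1) ≤
      (1.5 * 2 ^ r * 8 ^ (r - 1) * ((∏ i, p i : ℕ) * A ^ r) * 8) *
        (wordLength p A h * Real.log (Nat.log 2 h)) := by
  have key := le_mul_wordLength hp hr hA hs
  have hh0 : h ≠ 0 := by
    rintro rfl
    simp at hl
  have hlh := Nat.pow_log_le_self 2 hh0
  have hhl := Nat.lt_pow_succ_log_self one_lt_two h
  have hlaml := Nat.pow_log_le_self 2 (x := Nat.log 2 h) (by omega)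
  have hlam1 : 1 ≤ Nat.log 2 (Nat.log 2 h) :=
    Nat.le_log_of_pow_le one_lt_two (by omega)
  generalize wordLength p A h = n at *
  generalize Nat.log 2 h = l at *
  generalize hlam : Nat.log 2 l = mu at *
  have ln2 : 0.5 < Real.log 2 := by linarith [Real.log_two_gt_d9]
  have ln2' : Real.log 2 < 1 := by linarith [Real.log_two_lt_d9]
  have hl' : (4 : ℝ) ≤ l := by exact_mod_cast hl
  have hmu' : (1 : ℝ) ≤ mu := by exact_mod_cast hlam1
  have hL : Real.log h ≤ 2 * l := by
    have h1 : (h : ℝ) ≤ 2 ^ (l + 1) := by exact_mod_cast hhl.le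
    have h2 := Real.log_le_log (by positivity) h1
    rw [Real.log_pow] at h2
    push_cast at h2
    nlinarith
  have hL' : (l : ℝ) / 2 ≤ Real.log h := by
    have h1 : (2 : ℝ) ^ l ≤ h := by exact_mod_cast hlh
    have h2 := Real.log_le_log (by positivity) h1
    rw [Real.log_pow] at h2
    nlinarith
  have hmu : ((mu : ℝ) + 1) / 4 ≤ Real.log l := by
    have h1 : (2 : ℝ) ^ mu ≤ l := by exact_mod_cast hlaml
    have h2 := Real.log_le_log (by positivity) h1
    rw [Real.log_pow] at h2
    nlinarith
  have hLL : ((mu : ℝ) + 1) / 8 ≤ Real.log (Real.log h) := by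
    -- Here l ≥ 4 is needed: (log h)² ≥ l²/4 ≥ l, so log log h is at least half of log l.
    have h1 : (l : ℝ) ≤ Real.log h ^ 2 := by nlinarith
    have h2 := Real.log_le_log (by positivity) h1
    rw [Real.log_pow] at h2
    push_cast at h2
    linarith
  have hLpos : 0 ≤ Real.log h := by linarith
  have key' : (l : ℝ) ^ r ≤ ((∏ i, p i : ℕ) : ℝ) * (A * (mu + 1)) ^ r * (2 * n) := by
    exact_mod_cast key
  have hsplit : ((mu : ℝ) + 1) ^ r = (mu + 1) ^ (r - 1) * (mu + 1) := by
    rw [← pow_succ, Nat.sub_add_cancel hr]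
  calc 1.5 * Real.log h ^ r / Real.log (Real.log h) ^ (r - 1)
      ≤ 1.5 * (2 * l) ^ r / (((mu : ℝ) + 1) / 8) ^ (r - 1) := by gcongr
    _ = 1.5 * 2 ^ r * 8 ^ (r - 1) / ((mu : ℝ) + 1) ^ (r - 1) * l ^ r := by
      rw [mul_pow, div_pow]
      field_simp
    _ ≤ 1.5 * 2 ^ r * 8 ^ (r - 1) / ((mu : ℝ) + 1) ^ (r - 1) *
        (((∏ i, p i : ℕ) : ℝ) * (A * (mu + 1)) ^ r * (2 * n)) := by gcongr
    _ = (1.5 * 2 ^ r * 8 ^ (r - 1) * ((∏ i, p i : ℕ) * A ^ r) * 8) *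
        (n * (((mu : ℝ) + 1) / 4)) := by
      rw [mul_pow, hsplit]
      field_simp
      ring
    _ ≤ _ := by gcongr

end parameters

/-! ### The set-system and its construction by a program. -/

section system

variable {r : ℕ} (p α : Fin r → ℕ)

/-- The constant by which the logarithm of the number of points is divided. -/
def scaleFactor : ℕ := 2 * (r + 1) * ∑ i, α i * (p i ^ α i).totient

/-- The incidence vector of the member of the set-system that belongs to the word `w`. -/
def memberVector (h : ℕ) (w : List (List ℕ)) : List ℕ :=
  incidence (idempotentResidue p α) (fun i => idempotentResidue p α i * (p i ^ α i - 1))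
    (fun i => α i * (p i ^ α i).totient)
    (fun i => p i ^ exponent p (scaleFactor p α) h i - 1) w

/-- The words that index the members of the set-system. -/
def indexWords (h : ℕ) : List (List (List ℕ)) :=
  words (unitVectors (Nat.log 2 h)) (wordLength p (scaleFactor p α) h)

/-- The incidence vectors of all members: the empty set, and, from `h₀` points on, one set for
each word; for fewer points a single set of `m` points, if there are so many. -/
def systemVectors (m h₀ h : ℕ) : List (List ℕ) :=
  -- Comparisons appear as vanishing truncated differences, the form of test used in
  -- `Feasible.cases` and `Feasible.ite`.
  [] :: if h₀ - h = 0 then (indexWords p α h).map (memberVector p α h) else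
    if m - h = 0 then [List.replicate m 1] else []

/-- The list of the members. -/
def systemList (m h₀ h : ℕ) : List (Finset (Fin h)) :=
  (systemVectors p α m h₀ h).map (supportSet h)

/-- `h` is large enough for the construction with one set for each word. -/
structure IsLarge (h : ℕ) : Prop where
  le_scale : ∀ i, p i ≤ scale (scaleFactor p α) h
  four_le_log : 4 ≤ Nat.log 2 h
  sq_le : (∑ i, (idempotentResidue p α i + idempotentResidue p α i * (p i ^ α i - 1))) *
    (∑ i, (idempotentResidue p α i + idempotentResidue p α i * (p i ^ α i - 1))) ≤ h

variable {p α}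

theorem scaleFactor_pos (hr : 0 < r) (hp : ∀ i, (p i).Prime) (hα : ∀ i, 0 < α i) :
    0 < scaleFactor p α :=
  Nat.mul_pos (by omega) (Finset.sum_pos (fun i _ => Nat.mul_pos (hα i)
    (Nat.totient_pos.2 (Nat.pow_pos (hp i).pos))) ⟨⟨0, hr⟩, Finset.mem_univ _⟩)

theorem exists_isLarge (hr : 0 < r) (hp : ∀ i, (p i).Prime) (hα : ∀ i, 0 < α i) :
    ∃ h₀, ∀ h, h₀ ≤ h → IsLarge p α h := by
  refine ⟨max (2 ^ 2 ^ (2 * ((∑ i, p i) * scaleFactor p α) + 3)) (max 16 ((∑ i,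
    (idempotentResidue p α i + idempotentResidue p α i * (p i ^ α i - 1))) *
    (∑ i, (idempotentResidue p α i + idempotentResidue p α i * (p i ^ α i - 1))))),
    fun h hh => ?_⟩
  rw [max_le_iff, max_le_iff] at hh
  refine ⟨fun i => ?_, Nat.le_log_of_pow_le one_lt_two (by omega), hh.2.2⟩
  -- The threshold was taken with D = (∑ p i) * `scaleFactor`, which makes the scale at least ∑ p i.
  have h1 := mul_log_log_le _ h hh.1
  rw [scale, Nat.le_div_iff_mul_le (Nat.mul_pos (scaleFactor_pos hr hp hα) (by omega)),
    ← mul_assoc]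
  refine le_trans ?_ h1
  gcongr
  exact Finset.single_le_sum (f := p) (fun _ _ => Nat.zero_le _) (Finset.mem_univ i)

variable {h : ℕ}

theorem IsLarge.scale_pos (hl : IsLarge p α h) (hr : 0 < r) (hp : ∀ i, (p i).Prime) :
    0 < scale (scaleFactor p α) h :=
  (hp ⟨0, hr⟩).pos.trans_le (hl.le_scale _)

theorem IsLarge.ne_zero (hl : IsLarge p α h) : h ≠ 0 := by
  rintro rfl
  simpa using hl.four_le_log

theorem mul_tensorExponent_le_scaleFactor (i : Fin r) :
    2 * (r + 1) * (α i * (p i ^ α i).totient) ≤ scaleFactor p α :=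
  Nat.mul_le_mul_left _ (Finset.single_le_sum (f := fun i => α i * (p i ^ α i).totient)
    (fun _ _ => Nat.zero_le _) (Finset.mem_univ i))

theorem IsLarge.length_memberVector_le (hl : IsLarge p α h) (hr : 0 < r)
    (hp : ∀ i, (p i).Prime) {w : List (List ℕ)} (hw : w ∈ indexWords p α h) :
    (memberVector p α h w).length ≤ h :=
  length_incidence_le hp (hl.scale_pos hr hp) mul_tensorExponent_le_scaleFactor hl.sq_le
    hl.ne_zero hw

theorem memberVector_le_one {w : List (List ℕ)} (hw : w ∈ indexWords p α h) :
    ∀ x ∈ memberVector p α h w, x ≤ 1 :=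
  incidence_le_one _ _ _ _ _ fun u hu => le_one_of_mem_unitVectors ((mem_words.1 hw).2 u hu)

theorem IsLarge.card_inter (hl : IsLarge p α h) (hr : 0 < r) (hp : ∀ i, (p i).Prime)
    {w w' : List (List ℕ)} (hw : w ∈ indexWords p α h) (hw' : w' ∈ indexWords p α h) :
    (supportSet h (memberVector p α h w) ∩ supportSet h (memberVector p α h w')).card =
      intersectionSize p α (fun i => p i ^ exponent p (scaleFactor p α) h i - 1)
        (agreement w w') := by
  have h1 := mem_words.1 hw
  have h2 := mem_words.1 hw'
  exact card_inter_supportSet _ _ _ _ h1.2 h2.2 (h1.1.trans h2.1.symm)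
    (hl.length_memberVector_le hr hp hw)

theorem IsLarge.card_inter_mod (hl : IsLarge p α h) (hr : 0 < r) (hp : ∀ i, (p i).Prime)
    (hpinj : Function.Injective p) (hα : ∀ i, 0 < α i)
    {w w' : List (List ℕ)} (hw : w ∈ indexWords p α h) (hw' : w' ∈ indexWords p α h) :
    (supportSet h (memberVector p α h w) ∩ supportSet h (memberVector p α h w')).card %
      (∏ i, p i ^ α i) = 0 ↔ w = w' := by
  have h1 := mem_words.1 hw
  have h2 := mem_words.1 hw'
  have h3 := agreement_le h1.2 h2.2 (h1.1.trans h2.1.symm)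
  rw [← h3.2, hl.card_inter hr hp hw hw', h1.1]
  rw [h1.1] at h3
  exact intersectionSize_mod_prod hp hpinj hα h3.1

theorem IsLarge.card_mod (hl : IsLarge p α h) (hr : 0 < r) (hp : ∀ i, (p i).Prime)
    (hpinj : Function.Injective p) (hα : ∀ i, 0 < α i) {w : List (List ℕ)}
    (hw : w ∈ indexWords p α h) :
    (supportSet h (memberVector p α h w)).card % (∏ i, p i ^ α i) = 0 := by
  simpa using hl.card_inter_mod hr hp hpinj hα hw hw

theorem IsLarge.card_pos (hl : IsLarge p α h) (hr : 0 < r) (hp : ∀ i, (p i).Prime)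
    {w : List (List ℕ)} (hw : w ∈ indexWords p α h) :
    0 < (supportSet h (memberVector p α h w)).card := by
  have h1 := hl.card_inter hr hp hw hw
  rw [Finset.inter_self] at h1
  rw [h1, intersectionSize]
  exact Finset.sum_pos (fun i _ => Nat.add_pos_left (idempotentResidue_pos hp i) _)
    ⟨⟨0, hr⟩, Finset.mem_univ _⟩

theorem mem_systemList {m h₀ : ℕ} (hlarge : ∀ h, h₀ ≤ h → IsLarge p α h)
    {S : Finset (Fin h)} : S ∈ systemList p α m h₀ h ↔ S = ∅ ∨
      (IsLarge p α h ∧ h₀ ≤ h ∧ ∃ w ∈ indexWords p α h, S = supportSet h (memberVector p α h w)) ∨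
      (h < h₀ ∧ m ≤ h ∧ S = supportSet h (List.replicate m 1)) := by
  have h1 : supportSet h [] = ∅ := by simp [supportSet]
  rw [systemList, systemVectors, List.map_cons, h1, List.mem_cons]
  refine or_congr_right ?_
  by_cases hh : h₀ ≤ h
  · rw [if_pos (Nat.sub_eq_zero_of_le hh)]
    simp [hh, hlarge h hh, hh.not_gt, eq_comm]
  · rw [if_neg (by omega)]
    by_cases hmh : m ≤ h
    · simp [hh, hmh, Nat.sub_eq_zero_of_le hmh, not_le.1 hh]
    · simp [hh, hmh]
      omega

theorem card_supportSet_replicate {m : ℕ} (hm : m ≤ h) :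
    (supportSet h (List.replicate m 1)).card = m := by
  rw [card_supportSet (by simpa) (by simp)]
  simp

theorem nodup_systemList (hr : 0 < r) (hp : ∀ i, (p i).Prime)
    (hpinj : Function.Injective p) (hα : ∀ i, 0 < α i) {m h₀ : ℕ} (hm : 0 < m)
    (hlarge : ∀ h, h₀ ≤ h → IsLarge p α h) : (systemList p α m h₀ h).Nodup := by
  have h1 : supportSet h [] = ∅ := by simp [supportSet]
  rw [systemList, systemVectors, List.map_cons, h1, List.nodup_cons]
  by_cases hh : h₀ ≤ h
  · have hl := hlarge h hh
    rw [if_pos (Nat.sub_eq_zero_of_le hh), List.map_map]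
    constructor
    · rw [List.mem_map]
      rintro ⟨w, hw, h2⟩
      have h3 := hl.card_pos hr hp hw
      rw [Function.comp_apply] at h2
      simp [h2] at h3
    · refine List.Nodup.map_on (fun w hw w' hw' h2 => ?_)
        (nodup_words (nodup_unitVectors _) _)
      -- Equal supports intersect in a set of size 0 modulo m, which happens only for equal words.
      rw [← hl.card_inter_mod hr hp hpinj hα hw hw']
      have h3 := hl.card_mod hr hp hpinj hα hw
      simp only [Function.comp_apply] at h2
      rwa [← h2, Finset.inter_self]
  · rw [if_neg (by omega)]
    by_cases hmh : m ≤ h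
    · rw [if_pos (Nat.sub_eq_zero_of_le hmh)]
      simp only [List.map_cons, List.map_nil, List.mem_singleton, List.nodup_singleton, and_true]
      intro h2
      have h3 := card_supportSet_replicate hmh
      rw [← h2, Finset.card_empty] at h3
      omega
    · rw [if_neg (by omega)]
      simp

theorem length_systemList_of_le {m h₀ : ℕ} (hh : h₀ ≤ h) : (systemList p α m h₀ h).length =
    Nat.log 2 h ^ wordLength p (scaleFactor p α) h + 1 := by
  simp [systemList, systemVectors, Nat.sub_eq_zero_of_le hh, indexWords, length_words,
    length_unitVectors]

theorem length_systemVectors_le (hr : 0 < r) (hp : ∀ i, (p i).Prime) {m h₀ : ℕ}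
    (hlarge : ∀ h, h₀ ≤ h → IsLarge p α h) :
    ∀ v ∈ systemVectors p α m h₀ h, v.length ≤ h ∧ ∀ x ∈ v, x ≤ 1 := by
  intro v hv
  rw [systemVectors, List.mem_cons] at hv
  rcases hv with rfl | hv
  · simp
  split_ifs at hv with h1 h2
  · have hl := hlarge h (by omega)
    rw [List.mem_map] at hv
    obtain ⟨w, hw, rfl⟩ := hv
    exact ⟨hl.length_memberVector_le hr hp hw, memberVector_le_one hw⟩
  · rw [List.mem_singleton] at hv
    subst hv
    simp
    omega
  · simp at hv

theorem feasible_memberVector {ι : Type} {B h : ι → ℕ} (hlarge : ∀ i, IsLarge p α (h i))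
    (hr : 0 < r) (hp : ∀ i, (p i).Prime) (hα : ∀ i, 0 < α i) (hB : PolyBounded B h)
    (hpow : PolyBounded B fun i => Nat.log 2 (h i) ^ wordLength p (scaleFactor p α) (h i)) :
    Feasible B h fun i => (indexWords p α (h i)).map (memberVector p α (h i)) := by
  have hlogle : ∀ n, Nat.log 2 n ≤ n := fun n => Nat.log_le_self _ _
  have hlB : PolyBounded B fun i => Nat.log 2 (h i) := hB.mono fun i => hlogle _
  have hl : Feasible B h fun i => Nat.log 2 (h i) :=
    (Feasible.log_div one_lt_two Feasible.id hB (Feasible.const 1) (PolyBounded.const 1)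
      (fun _ => one_pos)).fst.of_eq fun i => by simp
  have hlam : Feasible B h fun i => Nat.log 2 (Nat.log 2 (h i)) + 1 :=
    ((Feasible.log_div one_lt_two hl hlB (Feasible.const 1) (PolyBounded.const 1)
      (fun _ => one_pos)).fst.of_eq fun i => by simp).succ
  have hlamB : PolyBounded B fun i => Nat.log 2 (Nat.log 2 (h i)) + 1 :=
    (hlB.mono fun i => hlogle _).add (PolyBounded.const 1)
  have hd := (Feasible.const (scaleFactor p α)).mul hlam (PolyBounded.const _) hlamB
  have hdB := (PolyBounded.const (B := B) (scaleFactor p α)).mul hlamB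
  have hP : ∀ t, Feasible B h fun i => p t ^ exponent p (scaleFactor p α) (h i) t := fun t =>
    (Feasible.log_div (hp t).one_lt hl hlB hd hdB fun i =>
      Nat.mul_pos (scaleFactor_pos hr hp hα) (Nat.succ_pos _)).snd
  have hPB : ∀ t, PolyBounded B fun i => p t ^ exponent p (scaleFactor p α) (h i) t := fun t =>
    hlB.mono fun i => pow_exponent_le ((hlarge i).scale_pos hr hp) t
  have hprod := Feasible.constProd (List.finRange r) hP hPB
  have hn : Feasible B h fun i => wordLength p (scaleFactor p α) (h i) :=
    hprod.1.pred.of_eq fun i => by rw [wordLength, Fin.prod_univ_def]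
  have hnB : PolyBounded B fun i => wordLength p (scaleFactor p α) (h i) :=
    hprod.2.mono fun i => by
      rw [wordLength, Fin.prod_univ_def]
      exact Nat.sub_le _ _
  have hW : Feasible B h fun i => indexWords p α (h i) := by
    refine Feasible.words (Feasible.unitVectors hl hlB) ?_ ?_ hn hnB ?_
    · exact hlB.mono fun i => (length_unitVectors _).le
    · intro i
      rw [length_unitVectors]
      exact zero_lt_four.trans_le (hlarge i).four_le_log
    · exact hpow.mono fun i => by rw [length_unitVectors]
  refine Feasible.map hW (hpow.mono fun i => ?_) ?_
  · rw [indexWords, length_words, length_unitVectors]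
  · have hlen : ∀ j : {j : ι × List (List ℕ) // j.2 ∈ indexWords p α (h j.1)},
        j.1.2.length = wordLength p (scaleFactor p α) (h j.1.1) := fun j => (mem_words.1 j.2).1
    refine Feasible.incidence _ _ _ (q := fun j => Nat.log 2 (h j.1.1)) Feasible.id.snd
      ((hnB.reindex fun j => j.1.1).mono fun j => (hlen j).le) (hlB.reindex fun j => j.1.1) ?_ ?_
      (fun t => ((hP t).lift (fun j => j.1.1) Feasible.id.fst).pred) fun t => ?_
    · exact fun j u hu => (length_of_mem_unitVectors ((mem_words.1 j.2).2 u hu)).le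
    · exact fun j u hu => le_one_of_mem_unitVectors ((mem_words.1 j.2).2 u hu)
    · refine (hB.reindex fun j => j.1.1).mono fun j => ?_
      -- The estimate with K = 1 suffices: the tensor exponents are constants, so their powers stay
      -- polynomial.
      have h1 : 2 * (r + 1) * 1 ≤ scaleFactor p α :=
        (Nat.mul_le_mul_left _ (Nat.mul_pos (hα t)
          (Nat.totient_pos.2 (Nat.pow_pos (hp t).pos)))).trans
          (mul_tensorExponent_le_scaleFactor t)
      have h2 := selection_pow_sq_le hp (hlarge j.1.1).ne_zero ((hlarge j.1.1).scale_pos hr hp)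
        h1 t
      rw [hlen j]
      rw [pow_one] at h2
      exact (Nat.le_mul_self _).trans h2

theorem explicitlyConstructible_systemList (hr : 0 < r) (hp : ∀ i, (p i).Prime)
    (hpinj : Function.Injective p) (hα : ∀ i, 0 < α i) {m h₀ : ℕ} (hm : 0 < m)
    (hlarge : ∀ h, h₀ ≤ h → IsLarge p α h) :
    ExplicitlyConstructible fun h => (systemList p α m h₀ h).toFinset := by
  set B : ℕ → ℕ := fun h => h + (systemList p α m h₀ h).toFinset.card with hBdef
  have hcard : ∀ h, (systemList p α m h₀ h).toFinset.card = (systemVectors p α m h₀ h).length :=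
    fun h => by
      rw [List.toFinset_card_of_nodup (nodup_systemList hr hp hpinj hα hm hlarge), systemList,
        List.length_map]
  have hB : PolyBounded B fun h => h := PolyBounded.self.mono fun h => Nat.le_add_right _ _
  have hvec : Feasible B (fun h => h) fun h => systemVectors p α m h₀ h := by
    -- The program for large `h` is known to be correct and fast only from `h₀` on, hence a case
    -- distinction with restricted index types.
    refine Feasible.cons (Feasible.const []) (Feasible.cases
      ((Feasible.const h₀).sub Feasible.id hB) ?_ ?_)
    · have hle : ∀ i : {h // h₀ - h = 0}, h₀ ≤ (i : ℕ) := fun i =>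
        Nat.le_of_sub_eq_zero i.2
      refine (feasible_memberVector (h := fun i : {h // h₀ - h = 0} => (i : ℕ))
        (fun i => hlarge _ (hle i)) hr hp hα (hB.reindex Subtype.val) ?_).of_eq fun i => ?_
      · refine (PolyBounded.self.reindex (B := B) Subtype.val).mono fun i => ?_
        have h1 := length_systemList_of_le (p := p) (α := α) (m := m) (hle i)
        have h2 := hcard i
        rw [systemList, List.length_map] at h1
        simp only [hBdef]
        omega
      · rw [if_pos i.2]
    · refine (Feasible.ite ((Feasible.const m).sub Feasible.id (hB.reindex Subtype.val))
        (Feasible.const [List.replicate m 1]) (Feasible.const [])).of_eq fun i => ?_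
      rw [if_neg i.2]
  have hout : Feasible B (fun h => h) fun h =>
      (systemVectors p α m h₀ h).map (padded h) := by
    refine Feasible.map (g := fun h => padded h) hvec (PolyBounded.self.mono fun h => ?_)
      (Feasible.padded Feasible.id.fst ?_ Feasible.id.snd ?_)
    · rw [← hcard]
      exact Nat.le_add_left _ _
    · exact hB.reindex fun j => j.1.1
    · exact (hB.reindex fun j => j.1.1).mono fun j =>
        (length_systemVectors_le hr hp hlarge _ j.2).1
  obtain ⟨P, hP, T, hT⟩ := hout
  refine ⟨P, T, fun h => ⟨⟨systemList p α m h₀ h, nodup_systemList hr hp hpinj hα hm hlarge,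
    fun S => List.mem_toFinset.symm, ?_⟩, hT h⟩⟩
  refine (hP h).trans ?_
  change Data.ofList _ = Data.ofList _
  rw [systemList, List.map_map, List.map_map]
  congr 1
  refine List.map_congr_left fun v hv => ?_
  have h1 := length_systemVectors_le hr hp hlarge v hv
  exact code_padded h1.1 h1.2

end system

/-! ### The constant c and the final verification. -/

/-- Used for the finitely many `h` below `h₀`, where the system has only two members and c X < log 2
is required. -/
theorem exists_pos_forall_mul_lt {y : ℝ} (hy : 0 < y) (X : ℕ → ℝ) (n : ℕ) :
    ∃ c : ℝ, 0 < c ∧ ∀ h < n, c * X h < y := by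
  have hS : 0 ≤ ∑ h ∈ Finset.range n, |X h| := Finset.sum_nonneg fun _ _ => abs_nonneg _
  refine ⟨y / (1 + ∑ h ∈ Finset.range n, |X h|), by positivity, fun h hh => ?_⟩
  have h1 : |X h| ≤ ∑ h ∈ Finset.range n, |X h| :=
    Finset.single_le_sum (f := fun h => |X h|) (fun _ _ => abs_nonneg _) (Finset.mem_range.2 hh)
  rw [div_mul_eq_mul_div, div_lt_iff₀ (by positivity)]
  have h2 := le_abs_self (X h)
  gcongr
  linarith

theorem theorem1 (r : ℕ) (hr : 1 < r) (p α : Fin r → ℕ)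
    (hp : ∀ i, (p i).Prime) (hpinj : Function.Injective p) (hα : ∀ i, 0 < α i)
    (m : ℕ) (hm : m = ∏ i, p i ^ α i) :
    ∃ c : ℝ, 0 < c ∧
      ∃ 𝓗 : (h : ℕ) → Finset (Finset (Fin h)),
        ExplicitlyConstructible 𝓗 ∧
        ∀ h : ℕ, m ≤ h →
          NonUniform (𝓗 h) ∧
          Real.exp (c * (1.5 * Real.log h ^ r / Real.log (Real.log h) ^ (r - 1)))
            < ((𝓗 h).card : ℝ) ∧
          (∀ H ∈ 𝓗 h, H.card % m = 0) ∧
          (∀ G ∈ 𝓗 h, ∀ H ∈ 𝓗 h, G ≠ H →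
            ((H ⊂ G ∨ G ⊂ H) → (G ∩ H).card % m = 0) ∧
            (¬ (H ⊂ G ∨ G ⊂ H) → (G ∩ H).card % m ≠ 0)) ∧
          (∀ G ∈ 𝓗 h, ∀ H ∈ 𝓗 h, G ≠ H → ∀ i : Fin r,
            (G ∩ H).card % (p i ^ α i) = 0 ∨ (G ∩ H).card % (p i ^ α i) = 1) := by
  have hr0 : 0 < r := by omega
  have hm0 : 0 < m := hm ▸ Finset.prod_pos fun i _ => Nat.pow_pos (hp i).pos
  obtain ⟨h₀, hlarge⟩ := exists_isLarge hr0 hp hα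
  obtain ⟨c₁, hc₁, hsmall⟩ := exists_pos_forall_mul_lt (Real.log_pos one_lt_two)
    (fun h => 1.5 * Real.log h ^ r / Real.log (Real.log h) ^ (r - 1)) h₀
  set C : ℝ := 1.5 * 2 ^ r * 8 ^ (r - 1) * ((∏ i, p i : ℕ) * (scaleFactor p α) ^ r) * 8 with hC
  have hA := scaleFactor_pos hr0 hp hα
  have hprod : 0 < ∏ i, p i := Finset.prod_pos fun i _ => (hp i).pos
  have hC0 : 0 < C := by positivity
  -- `c₁` serves the small `h`; `C` is the constant of `log_pow_div_le` for the large ones.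
  refine ⟨min c₁ C⁻¹, by positivity, fun h => (systemList p α m h₀ h).toFinset,
    explicitlyConstructible_systemList hr0 hp hpinj hα hm0 hlarge, fun h hmh => ?_⟩
  have hcard : (systemList p α m h₀ h).toFinset.card = (systemList p α m h₀ h).length :=
    List.toFinset_card_of_nodup (nodup_systemList hr0 hp hpinj hα hm0 hlarge)
  have hdiv : ∀ H ∈ (systemList p α m h₀ h).toFinset, H.card % m = 0 := by
    intro H hH
    rw [List.mem_toFinset, mem_systemList hlarge] at hH
    rcases hH with rfl | ⟨hl, _, w, hw, rfl⟩ | ⟨_, _, rfl⟩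
    · simp
    · rw [hm]
      exact hl.card_mod hr0 hp hpinj hα hw
    · rw [card_supportSet_replicate hmh, Nat.mod_self]
  have hpairs : ∀ G ∈ (systemList p α m h₀ h).toFinset,
      ∀ H ∈ (systemList p α m h₀ h).toFinset, G ≠ H → G = ∅ ∨ H = ∅ ∨
        (IsLarge p α h ∧ ∃ w ∈ indexWords p α h, ∃ w' ∈ indexWords p α h, w ≠ w' ∧
          G = supportSet h (memberVector p α h w) ∧ H = supportSet h (memberVector p α h w')) := by
    intro G hG H hH hGH
    rw [List.mem_toFinset, mem_systemList hlarge] at hG hH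
    rcases hG with hG | ⟨hl, h1, w, hw, rfl⟩ | ⟨h1, _, rfl⟩
    · exact Or.inl hG
    · rcases hH with hH | ⟨_, _, w', hw', rfl⟩ | ⟨h2, _, rfl⟩
      · exact Or.inr (Or.inl hH)
      · exact Or.inr (Or.inr ⟨hl, w, hw, w', hw', fun h => hGH (by rw [h]), rfl, rfl⟩)
      · omega
    · rcases hH with hH | ⟨_, h2, _⟩ | ⟨_, _, rfl⟩
      · exact Or.inr (Or.inl hH)
      · omega
      · exact absurd rfl hGH
  have hempty : ∅ ∈ (systemList p α m h₀ h).toFinset :=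
    List.mem_toFinset.2 ((mem_systemList hlarge).2 (Or.inl rfl))
  refine ⟨⟨∅, hempty, ?_⟩, ?_, hdiv, fun G hG H hH hGH => ⟨?_, ?_⟩, fun G hG H hH hGH i => ?_⟩
  · rcases le_or_gt h₀ h with hh | hh
    · have hl := hlarge h hh
      have hlen : 0 < (indexWords p α h).length := by
        rw [indexWords, length_words, length_unitVectors]
        exact Nat.pow_pos (zero_lt_four.trans_le hl.four_le_log)
      obtain ⟨w, hw⟩ := List.exists_mem_of_length_pos hlen
      refine ⟨_, List.mem_toFinset.2 ((mem_systemList hlarge).2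
        (Or.inr (Or.inl ⟨hl, hh, w, hw, rfl⟩))), ?_⟩
      rw [Finset.card_empty]
      exact (hl.card_pos hr0 hp hw).ne
    · refine ⟨_, List.mem_toFinset.2 ((mem_systemList hlarge).2
        (Or.inr (Or.inr ⟨hh, hmh, rfl⟩))), ?_⟩
      rw [card_supportSet_replicate hmh, Finset.card_empty]
      exact hm0.ne
  · rw [hcard]
    rcases le_or_gt h₀ h with hh | hh
    · have hl := hlarge h hh
      have hbase : (0 : ℝ) < Nat.log 2 h := by
        exact_mod_cast zero_lt_four.trans_le hl.four_le_log
      have h1 := log_pow_div_le hp hr0 hA hl.le_scale hl.four_le_log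
      rw [← hC] at h1
      have hlog : 0 ≤ (wordLength p (scaleFactor p α) h : ℝ) * Real.log (Nat.log 2 h) :=
        mul_nonneg (Nat.cast_nonneg _) (Real.log_natCast_nonneg _)
      have h2 : min c₁ C⁻¹ * (1.5 * Real.log h ^ r / Real.log (Real.log h) ^ (r - 1)) ≤
          wordLength p (scaleFactor p α) h * Real.log (Nat.log 2 h) := by
        calc _ ≤ min c₁ C⁻¹ * (C * (wordLength p (scaleFactor p α) h *
              Real.log (Nat.log 2 h))) := by gcongr
          _ ≤ C⁻¹ * (C * (wordLength p (scaleFactor p α) h * Real.log (Nat.log 2 h))) := by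
            gcongr
            exact min_le_right _ _
          _ = _ := by rw [inv_mul_cancel_left₀ hC0.ne']
      rw [length_systemList_of_le hh]
      push_cast
      refine lt_of_le_of_lt (Real.exp_le_exp.2 h2) ?_
      rw [← Real.log_pow, Real.exp_log (by positivity)]
      -- The empty set makes the inequality strict.
      exact lt_add_one _
    · have h1 : (systemList p α m h₀ h).length = 2 := by
        rw [systemList, systemVectors, if_neg (by omega), if_pos (by omega)]
        rfl
      rw [h1, Nat.cast_ofNat, ← Real.lt_log_iff_exp_lt two_pos]
      refine lt_of_le_of_lt ?_ (max_lt (hsmall h hh) (Real.log_pos one_lt_two))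
      -- Replacing `c₁` by the minimum is monotone only for nonnegative X; otherwise the product is
      -- at most 0 < log 2.
      rcases le_total 0 (1.5 * Real.log h ^ r / Real.log (Real.log h) ^ (r - 1)) with h2 | h2
      · exact le_max_of_le_left (mul_le_mul_of_nonneg_right (min_le_left _ _) h2)
      · exact le_max_of_le_right (mul_nonpos_of_nonneg_of_nonpos (by positivity) h2)
  · rintro (h1 | h1)
    · rw [Finset.inter_eq_right.2 h1.subset]
      exact hdiv H hH
    · rw [Finset.inter_eq_left.2 h1.subset]
      exact hdiv G hG
  · intro hnot
    rcases hpairs G hG H hH hGH with rfl | rfl | ⟨hl, w, hw, w', hw', hne, rfl, rfl⟩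
    · exact absurd (Or.inr (Finset.empty_ssubset.2
        (Finset.nonempty_iff_ne_empty.2 hGH.symm))) hnot
    · exact absurd (Or.inl (Finset.empty_ssubset.2 (Finset.nonempty_iff_ne_empty.2 hGH))) hnot
    · rw [hm]
      exact fun h1 => hne ((hl.card_inter_mod hr0 hp hpinj hα hw hw').1 h1)
  · rcases hpairs G hG H hH hGH with rfl | rfl | ⟨hl, w, hw, w', hw', -, rfl, rfl⟩
    · simp
    · simp
    · rw [hl.card_inter hr0 hp hw hw', intersectionSize_mod hp hpinj hα]
      split_ifs <;> simp
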